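/- Let $n\ge 2$ and $\mu\in\mathbb R$, $\mu\neq0$. For $\tau\in\mathbb R$, $\eta,\gamma\in\mathbb R^n$, a skew-symmetric real $n\times n$ matrix $Q=(q^i_r)$ and a function $f$ of one real variable, put $$\alpha=\frac{2|y|}{1+\mu|x|^2},\qquad c=\frac{\tau(1-\mu|x|^2)+\langle\mu\gamma+\eta,x\rangle}{1+\mu|x|^2},\qquad \beta=f(c)\,dc,$$ $$V^i=-2(\tau+\langle\eta,x\rangle)x^i+|x|^2\eta^i+q^i_rx^r+\gamma^i .$$ Let $U\subseteq\mathbb R^n$ be a nonempty open set on which $F=\alpha+\beta$ is a Randers metric, i.e. $\alpha$ is a Riemannian metric, $\beta$ is a smooth 1-form and $\|\beta\|_\alpha<1$ on $U$. Suppose that $$Q\eta=-\mu(4\tau\gamma+Q\gamma),\qquad |\eta|^2=\mu(\mu|\gamma|^2-4\tau^2),$$ and that at every $t\in c(U)$ the function $f$ is differentiable with $$f'(t)\,\bigl(2\tau t-2t^2+\mu|\gamma|^2+\langle\eta,\gamma\rangle\bigr)=2(t-\tau)f(t).$$ (1) If $\eta\neq-\mu\gamma$, then $V$ is a conformal vector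 field of $(U,F)$ with conformal factor $c$, i.e. $V_{0|0}:=V_{i|j}y^iy^j=-2cF^2$, where $V_i=g_{im}V^m$, $g_{ij}=\frac12(F^2)_{y^iy^j}$ and $|$ is the horizontal covariant derivative of the Berwald connection of $F$. The field $V$ is not homothetic, i.e. it is not conformal with a constant factor. The metric $F$ is locally projectively flat (near every point of $U$ there are coordinates in which the spray coefficients are $G^i=P(x,y)y^i$) and of Douglas type ($G^i=\frac12\Gamma^i_{jk}(x)y^jy^k+P(x,y)y^i$). (2) For all $n\ge2$ and $\mu\ne0$ there are $\tau,\eta,\gamma,Q,f$ and $U$ satisfying all the conditions above with $\beta\neq0$ at every point of $U$ (hence $\eta\neq-\mu\gamma$). (3) Consequently, in every dimension $n\ge2$ there is a Randers metric $F=\alpha+\beta$ on a nonempty open subset of $\mathbb R^n$, with $\beta$ nowhere zero, that is both locally projectively flat and of Douglas type and that admits a non-homothetic conformal vector field. -/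

import Mathlib

open scoped ContDiff RealInnerProductSpace

noncomputable section

namespace FinslerChart

/-- The coordinate space `ℝⁿ`, with its Euclidean norm and inner product. -/
abbrev E (n : ℕ) : Type := EuclideanSpace ℝ (Fin n)

/-- The partial derivative `∂φ/∂zⁱ`. -/
def pd {n : ℕ} (i : Fin n) (φ : E n → ℝ) (z : E n) : ℝ :=
  fderiv ℝ φ z (EuclideanSpace.single i 1)

/-! ### Riemannian and Randers metrics on an open set of `ℝⁿ`

A metric is written as a function `F x y` of the point `x` and the tangent vector `y`. -/

/-- `α` is (the norm of) a smooth Riemannian metric on `U`: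
`α(x,y) = √(a_ij(x) yⁱ yʲ)` with `(a_ij)` smooth and positive definite. -/
def IsRiemannianOn {n : ℕ} (U : Set (E n)) (α : E n → E n → ℝ) : Prop :=
  ∃ a : E n → Matrix (Fin n) (Fin n) ℝ,
    (∀ i j, ContDiffOn ℝ ∞ (fun x => a x i j) U) ∧
    ∀ x ∈ U, (a x).PosDef ∧ ∀ y : E n, α x y = √(∑ i, ∑ j, a x i j * y i * y j)

/-- `α + β` is a Randers metric on `U`: `α` is a Riemannian metric, `β` is a smooth 1-form, and
`‖β‖_α < 1` at every point of `U` (as the unit sphere of `α_x` is compact and symmetric, this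
says that `β(x,y) < α(x,y)` for all `y ≠ 0`). -/
structure IsRandersOn {n : ℕ} (U : Set (E n)) (α : E n → E n → ℝ) (β : E n → E n →L[ℝ] ℝ) :
    Prop where
  riemannian : IsRiemannianOn U α
  smooth : ContDiffOn ℝ ∞ β U
  norm_lt_one : ∀ x ∈ U, ∀ y : E n, y ≠ 0 → β x y < α x y

/-- The function `F = α + β`. -/
def randers {n : ℕ} (α : E n → E n → ℝ) (β : E n → E n →L[ℝ] ℝ) (x y : E n) : ℝ :=
  α x y + β x y

/-! ### Spray, Berwald connection, and horizontal covariant derivative -/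

/-- The fundamental tensor `g_ij = ½ ∂²(F²)/∂yⁱ∂yʲ`. -/
def fundamentalTensor {n : ℕ} (F : E n → E n → ℝ) (x y : E n) : Matrix (Fin n) (Fin n) ℝ :=
  Matrix.of fun i j => (1 / 2) * pd i (fun v => pd j (fun w => F x w ^ 2) v) y

/-- The spray coefficients
`Gⁱ = ¼ gⁱˡ ( [F²]_{xᵏyˡ} yᵏ - [F²]_{xˡ} )`; geodesics satisfy `ẍⁱ + 2Gⁱ(x,ẋ) = 0`. -/
def sprayCoeff {n : ℕ} (F : E n → E n → ℝ) (x y : E n) (i : Fin n) : ℝ :=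
  (1 / 4) * ∑ l, (fundamentalTensor F x y)⁻¹ i l *
    ((∑ k, pd k (fun u => pd l (fun w => F u w ^ 2) y) x * y k) - pd l (fun u => F u y ^ 2) x)

/-- The nonlinear connection `Nⁱ_j = ∂Gⁱ/∂yʲ`. -/
def nonlinearConn {n : ℕ} (F : E n → E n → ℝ) (x y : E n) (i j : Fin n) : ℝ :=
  pd j (fun v => sprayCoeff F x v i) y

/-- The coefficients `Gⁱ_jk = ∂Nⁱ_j/∂yᵏ` of the Berwald connection. -/
def berwaldConn {n : ℕ} (F : E n → E n → ℝ) (x y : E n) (i j k : Fin n) : ℝ :=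
  pd k (fun v => nonlinearConn F x v i j) y

/-- `V_i = g_im V^m`, a function of `(x,y)`. -/
def lowerIndex {n : ℕ} (F : E n → E n → ℝ) (V : E n → E n) (x y : E n) (i : Fin n) : ℝ :=
  ∑ m, fundamentalTensor F x y i m * V x m

/-- The horizontal covariant derivative with respect to the Berwald connection,
`V_{i|j} = ∂V_i/∂xʲ - Nᵏ_j ∂V_i/∂yᵏ - Gᵏ_ij V_k`. -/
def horizontalDeriv {n : ℕ} (F : E n → E n → ℝ) (V : E n → E n) (x y : E n) (i j : Fin n) : ℝ :=
  pd j (fun u => lowerIndex F V u y i) x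
    - ∑ k, nonlinearConn F x y k j * pd k (fun v => lowerIndex F V x v i) y
    - ∑ k, berwaldConn F x y k i j * lowerIndex F V x y k

/-- `V_{0|0} = V_{i|j} yⁱ yʲ`. -/
def V00 {n : ℕ} (F : E n → E n → ℝ) (V : E n → E n) (x y : E n) : ℝ :=
  ∑ i, ∑ j, horizontalDeriv F V x y i j * y i * y j

/-! ### Conformal and homothetic vector fields -/

/-- `V` is a conformal vector field of `(U, F)` with conformal factor `c`:
`V_{0|0} = -2 c F²` on the slit tangent bundle of `U`. -/
structure IsConformalWith {n : ℕ} (U : Set (E n)) (F : E n → E n → ℝ) (V : E n → E n)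
    (c : E n → ℝ) : Prop where
  smooth_field : ContDiffOn ℝ ∞ V U
  smooth_factor : ContDiffOn ℝ ∞ c U
  eq : ∀ x ∈ U, ∀ y : E n, y ≠ 0 → V00 F V x y = -2 * c x * F x y ^ 2

/-- `V` is a conformal vector field of `(U, F)`. -/
def IsConformal {n : ℕ} (U : Set (E n)) (F : E n → E n → ℝ) (V : E n → E n) : Prop :=
  ∃ c : E n → ℝ, IsConformalWith U F V c

/-- `V` is homothetic: conformal with a constant conformal factor. -/
def IsHomothetic {n : ℕ} (U : Set (E n)) (F : E n → E n → ℝ) (V : E n → E n) : Prop :=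
  ∃ k : ℝ, IsConformalWith U F V (fun _ => k)

/-! ### Local projective flatness and Douglas metrics -/

/-- `F` is projectively flat on `W` in the given coordinates (geodesics are straight lines):
`Gⁱ = P yⁱ` for some function `P(x,y)`. -/
def IsProjectivelyFlatOn {n : ℕ} (W : Set (E n)) (F : E n → E n → ℝ) : Prop :=
  ∃ P : E n → E n → ℝ, ∀ x ∈ W, ∀ y : E n, y ≠ 0 → ∀ i, sprayCoeff F x y i = P x y * y i

/-- `F` is locally projectively flat on `U`: around every point there are smooth coordinates
`φ` in which `F` is projectively flat. In these coordinates `F` reads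
`(x,y) ↦ F(φ⁻¹(x), d(φ⁻¹)_x y)`. -/
def IsLocallyProjectivelyFlat {n : ℕ} (U : Set (E n)) (F : E n → E n → ℝ) : Prop :=
  ∀ p ∈ U, ∃ φ : OpenPartialHomeomorph (E n) (E n), p ∈ φ.source ∧ φ.source ⊆ U ∧
    ContDiffOn ℝ ∞ φ φ.source ∧ ContDiffOn ℝ ∞ φ.symm φ.target ∧
    IsProjectivelyFlatOn φ.target (fun x y => F (φ.symm x) (fderiv ℝ φ.symm x y))

/-- `F` is of Douglas type on `U`:
`Gⁱ = ½ Γⁱ_jk(x) yʲ yᵏ + P(x,y) yⁱ`. -/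
def IsDouglas {n : ℕ} (U : Set (E n)) (F : E n → E n → ℝ) : Prop :=
  ∃ (Γ : E n → Fin n → Fin n → Fin n → ℝ) (P : E n → E n → ℝ),
    ∀ x ∈ U, ∀ y : E n, y ≠ 0 → ∀ i,
      sprayCoeff F x y i = (1 / 2) * (∑ j, ∑ k, Γ x i j k * y j * y k) + P x y * y i

/-! ### The family of metrics and vector fields -/

/-- `α = 2|y| / (1 + μ|x|²)`. -/
def alphaMu {n : ℕ} (μ : ℝ) (x y : E n) : ℝ :=
  2 / (1 + μ * ‖x‖ ^ 2) * ‖y‖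

/-- `c = (τ(1 - μ|x|²) + ⟨μγ + η, x⟩) / (1 + μ|x|²)`. -/
def factor {n : ℕ} (μ τ : ℝ) (η γ : E n) (x : E n) : ℝ :=
  (τ * (1 - μ * ‖x‖ ^ 2) + ⟪μ • γ + η, x⟫) / (1 + μ * ‖x‖ ^ 2)

/-- `β = f(c) dc`. -/
def betaForm {n : ℕ} (μ τ : ℝ) (η γ : E n) (f : ℝ → ℝ) (x : E n) : E n →L[ℝ] ℝ :=
  f (factor μ τ η γ x) • fderiv ℝ (factor μ τ η γ) x

/-- The Randers metric `F = α + β`. -/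
def metricF {n : ℕ} (μ τ : ℝ) (η γ : E n) (f : ℝ → ℝ) : E n → E n → ℝ :=
  randers (alphaMu μ) (betaForm μ τ η γ f)

/-- `Vⁱ = -2(τ + ⟨η,x⟩) xⁱ + |x|² ηⁱ + qⁱ_r xʳ + γⁱ`. -/
def fieldV {n : ℕ} (τ : ℝ) (η γ : E n) (Q : Matrix (Fin n) (Fin n) ℝ) (x : E n) : E n :=
  (-2 * (τ + ⟪η, x⟫)) • x + ‖x‖ ^ 2 • η + Matrix.toEuclideanLin Q x + γ

/-- The standing conditions on the data `(τ, η, γ, Q, f)` over the coordinate domain `U`. The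
differential equation for `f` is required on the range `c(U)` only and is written without
denominators, so that it also makes sense at zeros of `2τt - 2t² + μ|γ|² + ⟨η,γ⟩`. -/
structure Admissible {n : ℕ} (μ τ : ℝ) (η γ : E n) (Q : Matrix (Fin n) (Fin n) ℝ) (f : ℝ → ℝ)
    (U : Set (E n)) : Prop where
  isOpen : IsOpen U
  nonempty : U.Nonempty
  isRanders : IsRandersOn U (alphaMu μ) (betaForm μ τ η γ f)
  skew : Q.transpose = -Q
  Q_eta : Matrix.toEuclideanLin Q η = -(μ • ((4 * τ) • γ + Matrix.toEuclideanLin Q γ))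
  ode : ∀ t ∈ factor μ τ η γ '' U, DifferentiableAt ℝ f t ∧
    deriv f t * (2 * τ * t - 2 * t ^ 2 + μ * ‖γ‖ ^ 2 + ⟪η, γ⟫) = 2 * (t - τ) * f t
  eta_sq : ‖η‖ ^ 2 = μ * (μ * ‖γ‖ ^ 2 - 4 * τ ^ 2)

end FinslerChart

end

open FinslerChart

/-!
For any nondegenerate Finsler metric the contractions with `y` remove the Berwald connection from
`V_{0|0}`: by Euler's theorem and the geodesic equation, `V_{0|0} = F · V^c(F)`, where `V^c` is
the complete lift of `V` (`V00_eq_completeLift`). Hence `V` is conformal with factor `c` exactly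
when the Lie derivative of `F = α + β` along `V` is `-2cF`. For `α` this is a computation
(`completeLift_alphaMu`). The conditions on `Q` and `|η|²` turn `c` into a solution of the
autonomous equation `V(c) = 2τc - 2c² + μ|γ|² + ⟨η,γ⟩` (`fderiv_factor_fieldV`), and the
differential equation for `f` then says that the Lie derivative of `f(c) dc` is `-2c f(c) dc`.
Since `F > 0`, a conformal factor of `V` is unique, and `c` is constant on no open set because
`μγ + η ≠ 0`.

Projective properties are read off from the Euler–Lagrange covector `F_{xᵏyˡ} yᵏ - F_{xˡ}`: if it
equals `F_{yˡyᵐ} wᵐ`, then `Gⁱ = ½ wⁱ + P yⁱ` (`sprayCoeff_of_eulerLagrange`). The covector is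
additive in `F` and vanishes on closed forms, so `β` does not contribute. In the given coordinates
`w = 2μ|y|² x / (1 + μ|x|²)` is quadratic in `y`, so `F` is of Douglas type. For projective
flatness, read `x` as the stereographic coordinate of the point
`(2x, 1 - μ|x|²) / (1 + μ|x|²)` of the quadric `μ|W|² + Z² = 1`: central projection to the
hyperplane `Z + ⟨b,W⟩ = 1` gives a chart in which `α` is `√gram / quadric`, whose Euler–Lagrange
covector vanishes (`eulerLagrange_beltrami`). The choice `b = μp` makes this
chart regular at `p`, also when `1 - μ|p|² = 0`.

Both arguments need the fundamental tensor to be nonsingular, which is the strong convexity of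
Randers norms with `‖β‖_α < 1` (`det_fundamentalTensor_randers_ne_zero`).

For existence take `τ = 0`, `Q = 0`, a unit vector `γ` and `η = μγ`; then `f = ε / √(2μ² - 2μt²)`
solves the differential equation near `t = 0 = c(0)`, and a small `ε > 0` gives a Randers metric
near the origin.
-/

noncomputable section

namespace FinslerChart

open Filter Topology

/-! ### Smooth functions on the slit tangent bundle -/

/-- `f(x,y)` is smooth on the slit tangent bundle `U × (ℝⁿ ∖ {0})`. -/
def SlitSmooth {n : ℕ} (U : Set (E n)) (f : E n → E n → ℝ) : Prop :=
  ∀ x ∈ U, ∀ y : E n, y ≠ 0 → ContDiffAt ℝ ∞ (fun p : E n × E n => f p.1 p.2) (x, y)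

section SlitSmooth

variable {n : ℕ} {U : Set (E n)} {f g : E n → E n → ℝ}

theorem eventually_slit (hU : IsOpen U) {x y : E n} (hx : x ∈ U) (hy : y ≠ 0) :
    ∀ᶠ p : E n × E n in 𝓝 (x, y), p.1 ∈ U ∧ p.2 ≠ 0 :=
  (hU.prod isOpen_ne).mem_nhds (Set.mk_mem_prod hx hy)

theorem SlitSmooth.base (hf : SlitSmooth U f) {x y : E n} (hx : x ∈ U) (hy : y ≠ 0) :
    ContDiffAt ℝ ∞ (fun u => f u y) x :=
  ContDiffAt.comp (g := fun p : E n × E n => f p.1 p.2) (f := fun u : E n => (u, y)) x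
    (hf x hx y hy) (contDiffAt_id.prodMk contDiffAt_const)

theorem SlitSmooth.fiber (hf : SlitSmooth U f) {x y : E n} (hx : x ∈ U) (hy : y ≠ 0) :
    ContDiffAt ℝ ∞ (f x) y :=
  ContDiffAt.comp (g := fun p : E n × E n => f p.1 p.2) (f := fun v : E n => (x, v)) y
    (hf x hx y hy) (contDiffAt_const.prodMk contDiffAt_id)

theorem SlitSmooth.differentiableAt_base (hf : SlitSmooth U f) {x y : E n} (hx : x ∈ U)
    (hy : y ≠ 0) : DifferentiableAt ℝ (fun u => f u y) x :=
  (hf.base hx hy).differentiableAt (by simp)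

theorem SlitSmooth.differentiableAt_fiber (hf : SlitSmooth U f) {x y : E n} (hx : x ∈ U)
    (hy : y ≠ 0) : DifferentiableAt ℝ (f x) y :=
  (hf.fiber hx hy).differentiableAt (by simp)

theorem slitSmooth_const (a : ℝ) : SlitSmooth U fun _ _ => a :=
  fun _ _ _ _ => contDiffAt_const

theorem slitSmooth_coord (i : Fin n) : SlitSmooth U fun _ y => y i := fun _ _ _ _ => by
  fun_prop

theorem SlitSmooth.of_base (hU : IsOpen U) {φ : E n → ℝ} (hφ : ContDiffOn ℝ ∞ φ U) :
    SlitSmooth U fun x _ => φ x := fun x hx _ _ =>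
  (hφ.contDiffAt (hU.mem_nhds hx)).comp (x, _) contDiffAt_fst

theorem SlitSmooth.add (hf : SlitSmooth U f) (hg : SlitSmooth U g) :
    SlitSmooth U fun x y => f x y + g x y :=
  fun x hx y hy => (hf x hx y hy).add (hg x hx y hy)

theorem SlitSmooth.sub (hf : SlitSmooth U f) (hg : SlitSmooth U g) :
    SlitSmooth U fun x y => f x y - g x y :=
  fun x hx y hy => (hf x hx y hy).sub (hg x hx y hy)

theorem SlitSmooth.mul (hf : SlitSmooth U f) (hg : SlitSmooth U g) :
    SlitSmooth U fun x y => f x y * g x y :=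
  fun x hx y hy => (hf x hx y hy).mul (hg x hx y hy)

theorem SlitSmooth.pow (hf : SlitSmooth U f) (k : ℕ) : SlitSmooth U fun x y => f x y ^ k :=
  fun x hx y hy => (hf x hx y hy).pow k

theorem SlitSmooth.inv (hf : SlitSmooth U f) (h0 : ∀ x ∈ U, ∀ y : E n, y ≠ 0 → f x y ≠ 0) :
    SlitSmooth U fun x y => (f x y)⁻¹ :=
  fun x hx y hy => (hf x hx y hy).inv (h0 x hx y hy)

theorem SlitSmooth.sum {ι : Type*} {s : Finset ι} {f : ι → E n → E n → ℝ}
    (hf : ∀ i ∈ s, SlitSmooth U (f i)) : SlitSmooth U fun x y => ∑ i ∈ s, f i x y :=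
  fun x hx y hy => ContDiffAt.sum fun i hi => hf i hi x hx y hy

theorem SlitSmooth.prod {ι : Type*} {s : Finset ι} {f : ι → E n → E n → ℝ}
    (hf : ∀ i ∈ s, SlitSmooth U (f i)) : SlitSmooth U fun x y => ∏ i ∈ s, f i x y :=
  fun x hx y hy => contDiffAt_prod fun i hi => hf i hi x hx y hy

/-- Vertical directional derivatives of a smooth function are smooth. -/
theorem SlitSmooth.fderiv_fiber (hU : IsOpen U) (hf : SlitSmooth U f) (v : E n) :
    SlitSmooth U fun x y => fderiv ℝ (f x) y v := by
  intro x hx y hy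
  have h : ContDiffAt ℝ ∞ (fun p : E n × E n =>
      fderiv ℝ (fun p : E n × E n => f p.1 p.2) p (0, v)) (x, y) :=
    ((hf x hx y hy).fderiv_right (m := ∞) (by simp)).clm_apply contDiffAt_const
  refine h.congr_of_eventuallyEq ?_
  filter_upwards [eventually_slit hU hx hy] with p hp
  have h1 := ((hf p.1 hp.1 p.2 hp.2).differentiableAt (by simp)).hasFDerivAt
  have h2 := h1.comp (f := fun v : E n => (p.1, v)) p.2
    ((hasFDerivAt_const p.1 p.2).prodMk (hasFDerivAt_id p.2))
  have h3 : fderiv ℝ (f p.1) p.2 = _ := h2.fderiv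
  rw [h3]
  simp

/-- Derivatives of a smooth function in the direction of the base are smooth. -/
theorem SlitSmooth.fderiv_base (hU : IsOpen U) (hf : SlitSmooth U f) (v : E n) :
    SlitSmooth U fun x y => fderiv ℝ (fun u => f u y) x v := by
  intro x hx y hy
  have h : ContDiffAt ℝ ∞ (fun p : E n × E n =>
      fderiv ℝ (fun p : E n × E n => f p.1 p.2) p (v, 0)) (x, y) :=
    ((hf x hx y hy).fderiv_right (m := ∞) (by simp)).clm_apply contDiffAt_const
  refine h.congr_of_eventuallyEq ?_
  filter_upwards [eventually_slit hU hx hy] with p hp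
  have h1 := ((hf p.1 hp.1 p.2 hp.2).differentiableAt (by simp)).hasFDerivAt
  have h2 := h1.comp (f := fun u : E n => (u, p.2)) p.1
    ((hasFDerivAt_id p.1).prodMk (hasFDerivAt_const p.2 p.1))
  have h3 : fderiv ℝ (fun u => f u p.2) p.1 = _ := h2.fderiv
  rw [h3]
  simp

theorem SlitSmooth.pd_fiber (hU : IsOpen U) (hf : SlitSmooth U f) (i : Fin n) :
    SlitSmooth U fun x y => pd i (f x) y := hf.fderiv_fiber hU _

theorem SlitSmooth.pd_base (hU : IsOpen U) (hf : SlitSmooth U f) (i : Fin n) :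
    SlitSmooth U fun x y => pd i (fun u => f u y) x := hf.fderiv_base hU _

theorem SlitSmooth.det {ι : Type*} [Fintype ι] [DecidableEq ι] {M : E n → E n → Matrix ι ι ℝ}
    (hM : ∀ i j, SlitSmooth U fun x y => M x y i j) : SlitSmooth U fun x y => (M x y).det := by
  simp only [Matrix.det_apply']
  exact SlitSmooth.sum fun σ _ => (slitSmooth_const _).mul (SlitSmooth.prod fun i _ => hM _ _)

theorem SlitSmooth.matrix_inv {ι : Type*} [Fintype ι] [DecidableEq ι]
    {M : E n → E n → Matrix ι ι ℝ} (hM : ∀ i j, SlitSmooth U fun x y => M x y i j)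
    (hdet : ∀ x ∈ U, ∀ y : E n, y ≠ 0 → (M x y).det ≠ 0) (i j : ι) :
    SlitSmooth U fun x y => (M x y)⁻¹ i j := by
  simp only [Matrix.inv_def, Matrix.smul_apply, Ring.inverse_eq_inv', smul_eq_mul,
    Matrix.adjugate_apply]
  refine ((SlitSmooth.det hM).inv hdet).mul (SlitSmooth.det fun k l => ?_)
  by_cases hk : k = j
  · subst hk
    simpa only [Matrix.updateRow_self] using slitSmooth_const _
  · simpa only [Matrix.updateRow_ne hk] using hM k l

end SlitSmooth

/-! ### Partial derivatives and homogeneous functions -/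

section Homogeneous

variable {n : ℕ}

theorem sum_pd_mul (φ : E n → ℝ) (z v : E n) : ∑ i, pd i φ z * v i = fderiv ℝ φ z v := by
  have hv : v = ∑ i, v i • EuclideanSpace.single i (1 : ℝ) := by
    simpa using ((EuclideanSpace.basisFun (Fin n) ℝ).sum_repr v).symm
  conv_rhs => rw [hv, map_sum]
  simp only [map_smul, smul_eq_mul, pd]
  exact Finset.sum_congr rfl fun i _ => mul_comm _ _

theorem fderiv_fderiv_comm {φ : E n → ℝ} {z : E n} (h : ContDiffAt ℝ ∞ φ z) (v w : E n) :
    fderiv ℝ (fun u => fderiv ℝ φ u v) z w = fderiv ℝ (fun u => fderiv ℝ φ u w) z v := by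
  have hd : DifferentiableAt ℝ (fderiv ℝ φ) z :=
    (h.fderiv_right (m := ∞) (by simp)).differentiableAt (by simp)
  have key (a b : E n) : fderiv ℝ (fun u => fderiv ℝ φ u a) z b = fderiv ℝ (fderiv ℝ φ) z b a := by
    rw [fderiv_clm_apply hd (differentiableAt_const a)]
    simp
  rw [key, key]
  have h2 : ((2 : ℕ∞) : WithTop ℕ∞) ≤ ∞ := WithTop.coe_le_coe.2 le_top
  exact h.isSymmSndFDerivAt (by simpa using h2) w v

/-- `φ` is positively homogeneous of degree `k`. -/
def PosHom (k : ℕ) (φ : E n → ℝ) : Prop :=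
  ∀ t : ℝ, 0 < t → ∀ y, φ (t • y) = t ^ k * φ y

theorem PosHom.pow {k : ℕ} {φ : E n → ℝ} (h : PosHom k φ) (m : ℕ) :
    PosHom (k * m) fun y => φ y ^ m := fun t ht y => by
  simp only [h t ht y, mul_pow, pow_mul]

theorem PosHom.fderiv_apply {k : ℕ} {φ : E n → ℝ} (h : PosHom (k + 1) φ) (v : E n) :
    PosHom k fun y => fderiv ℝ φ y v := by
  intro t ht y
  have h1 : fderiv ℝ (fun z => φ (t • z)) y = t • fderiv ℝ φ (t • y) := fderiv_comp_smul t
  have h2 : (fun z => φ (t • z)) = fun z => t ^ (k + 1) * φ z := funext (h t ht)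
  have h3 : fderiv ℝ (fun z => t ^ (k + 1) * φ z) y = t ^ (k + 1) • fderiv ℝ φ y := by
    exact congrFun (fderiv_const_smul_field (𝕜 := ℝ) (R := ℝ) (t ^ (k + 1)) (f := φ)) y
  rw [h2, h3] at h1
  have h4 := congrArg (fun L => L v) h1
  simp only [smul_apply, smul_eq_mul] at h4
  apply mul_left_cancel₀ ht.ne'
  rw [← h4]
  ring

theorem PosHom.pd_apply {k : ℕ} {φ : E n → ℝ} (h : PosHom (k + 1) φ) (i : Fin n) :
    PosHom k fun y => pd i φ y := h.fderiv_apply _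

theorem PosHom.euler {k : ℕ} {φ : E n → ℝ} (h : PosHom k φ) {y : E n}
    (hd : DifferentiableAt ℝ φ y) : fderiv ℝ φ y y = k * φ y := by
  have h1 : HasDerivAt (fun t : ℝ => φ (t • y)) (fderiv ℝ φ y y) 1 := by
    have h0 : HasDerivAt (fun t : ℝ => t • y) y 1 := by
      simpa using (hasDerivAt_id (1 : ℝ)).smul_const y
    have hd' : HasFDerivAt φ (fderiv ℝ φ y) ((1 : ℝ) • y) := by
      rw [one_smul]; exact hd.hasFDerivAt
    exact hd'.comp_hasDerivAt (1 : ℝ) h0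
  have h2 : HasDerivAt (fun t : ℝ => t ^ k * φ y) (k * φ y) 1 := by
    simpa using (hasDerivAt_pow k (1 : ℝ)).mul_const (φ y)
  refine h1.unique (h2.congr_of_eventuallyEq ?_)
  filter_upwards [lt_mem_nhds (zero_lt_one' ℝ)] with t ht using h t ht y

theorem PosHom.sum_pd {k : ℕ} {φ : E n → ℝ} (h : PosHom k φ) {y : E n}
    (hd : DifferentiableAt ℝ φ y) : ∑ i, pd i φ y * y i = k * φ y := by
  rw [sum_pd_mul, h.euler hd]

end Homogeneous

/-! ### The spray and the complete lift of a vector field -/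

section Finsler

variable {n : ℕ} {U : Set (E n)} {F : E n → E n → ℝ}

theorem fundamentalTensor_apply (F : E n → E n → ℝ) (x y : E n) (i j : Fin n) :
    fundamentalTensor F x y i j = (1 / 2) * pd i (fun v => pd j (fun w => F x w ^ 2) v) y := rfl

theorem fundamentalTensor_symm (hF : SlitSmooth U F) {x y : E n} (hx : x ∈ U) (hy : y ≠ 0)
    (i j : Fin n) : fundamentalTensor F x y i j = fundamentalTensor F x y j i := by
  rw [fundamentalTensor_apply, fundamentalTensor_apply]
  congr 1
  exact fderiv_fderiv_comm ((hF.pow 2).fiber hx hy) _ _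

theorem SlitSmooth.fundamentalTensor (hU : IsOpen U) (hF : SlitSmooth U F) (i j : Fin n) :
    SlitSmooth U fun x y => fundamentalTensor F x y i j :=
  (slitSmooth_const _).mul (((hF.pow 2).pd_fiber hU j).pd_fiber hU i)

theorem SlitSmooth.sprayCoeff (hU : IsOpen U) (hF : SlitSmooth U F)
    (hdet : ∀ x ∈ U, ∀ y : E n, y ≠ 0 → (FinslerChart.fundamentalTensor F x y).det ≠ 0)
    (i : Fin n) : SlitSmooth U fun x y => sprayCoeff F x y i :=
  (slitSmooth_const _).mul <| SlitSmooth.sum fun l _ =>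
    (SlitSmooth.matrix_inv (hF.fundamentalTensor hU) hdet i l).mul <|
      (SlitSmooth.sum fun k _ =>
        (((hF.pow 2).pd_fiber hU l).pd_base hU k).mul (slitSmooth_coord k)).sub
      ((hF.pow 2).pd_base hU l)

/-- The defining equation of the spray, `g_li Gⁱ = ¼ ([F²]_{xᵏyˡ} yᵏ - [F²]_{xˡ})`. -/
theorem sum_fundamentalTensor_mul_sprayCoeff {x y : E n}
    (hdet : (fundamentalTensor F x y).det ≠ 0) (l : Fin n) :
    ∑ i, fundamentalTensor F x y l i * sprayCoeff F x y i =
      (1 / 4) * ((∑ k, pd k (fun u => pd l (fun w => F u w ^ 2) y) x * y k)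
        - pd l (fun u => F u y ^ 2) x) := by
  set g := fundamentalTensor F x y
  set b : Fin n → ℝ := fun l => (∑ k, pd k (fun u => pd l (fun w => F u w ^ 2) y) x * y k)
        - pd l (fun u => F u y ^ 2) x with hb
  have h1 : g.mulVec (g⁻¹.mulVec b) = b := by
    rw [Matrix.mulVec_mulVec, Matrix.mul_nonsing_inv _ (isUnit_iff_ne_zero.2 hdet),
      Matrix.one_mulVec]
  have h2 : ∀ i, sprayCoeff F x y i = (1 / 4) * g⁻¹.mulVec b i := fun i => rfl
  have h3 := congrFun h1 l
  rw [Matrix.mulVec, dotProduct] at h3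
  calc ∑ i, g l i * sprayCoeff F x y i = (1 / 4) * ∑ i, g l i * g⁻¹.mulVec b i := by
        rw [Finset.mul_sum]
        exact Finset.sum_congr rfl fun i _ => by rw [h2]; ring
    _ = _ := by rw [h3]

theorem posHom_fundamentalTensor (hhom : ∀ x, PosHom 1 (F x)) (x : E n) (i j : Fin n) :
    PosHom 0 fun y => fundamentalTensor F x y i j := fun t ht y => by
  simp only [fundamentalTensor_apply]
  have h := (((hhom x).pow 2).pd_apply j).pd_apply i t ht y
  simp only at h
  rw [h]
  ring

theorem posHom_sprayCoeff (hhom : ∀ x, PosHom 1 (F x)) (x : E n) (i : Fin n) :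
    PosHom 2 fun y => sprayCoeff F x y i := fun t ht y => by
  have hg : fundamentalTensor F x (t • y) = fundamentalTensor F x y := by
    ext i j
    simpa using posHom_fundamentalTensor hhom x i j t ht y
  have h1 (k l : Fin n) : pd k (fun u => pd l (fun w => F u w ^ 2) (t • y)) x
      = t * pd k (fun u => pd l (fun w => F u w ^ 2) y) x := by
    have : (fun u => pd l (fun w => F u w ^ 2) (t • y))
        = t • fun u => pd l (fun w => F u w ^ 2) y := by
      funext u
      simpa using (((hhom u).pow 2).pd_apply l) t ht y
    rw [pd, this, fderiv_const_smul_field]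
    rfl
  have h2 (l : Fin n) : pd l (fun u => F u (t • y) ^ 2) x
      = t ^ 2 * pd l (fun u => F u y ^ 2) x := by
    have : (fun u => F u (t • y) ^ 2) = t ^ 2 • fun u => F u y ^ 2 := by
      funext u
      simpa using ((hhom u).pow 2) t ht y
    rw [pd, this, fderiv_const_smul_field]
    rfl
  simp only [sprayCoeff, hg, h1, h2, PiLp.smul_apply, smul_eq_mul, Finset.mul_sum, mul_sub]
  refine Finset.sum_congr rfl fun l _ => ?_
  congr 1
  · refine Finset.sum_congr rfl fun k _ => by ring
  · ring

theorem sum_mul_fundamentalTensor (hU : IsOpen U) (hF : SlitSmooth U F)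
    (hhom : ∀ x, PosHom 1 (F x)) {x y : E n} (hx : x ∈ U) (hy : y ≠ 0) (m : Fin n) :
    ∑ i, fundamentalTensor F x y i m * y i = (1 / 2) * pd m (fun w => F x w ^ 2) y := by
  have h := (((hhom x).pow 2).pd_apply m).sum_pd
    (((hF.pow 2).pd_fiber hU m).differentiableAt_fiber hx hy)
  simp only [fundamentalTensor_apply]
  rw [← one_mul (pd m _ y), ← Nat.cast_one, ← h, Finset.mul_sum]
  exact Finset.sum_congr rfl fun i _ => by ring

theorem sum_nonlinearConn_mul (hU : IsOpen U) (hF : SlitSmooth U F)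
    (hhom : ∀ x, PosHom 1 (F x))
    (hdet : ∀ x ∈ U, ∀ y : E n, y ≠ 0 → (fundamentalTensor F x y).det ≠ 0)
    {x y : E n} (hx : x ∈ U) (hy : y ≠ 0) (k : Fin n) :
    ∑ j, nonlinearConn F x y k j * y j = 2 * sprayCoeff F x y k := by
  exact_mod_cast (posHom_sprayCoeff hhom x k).sum_pd
    ((hF.sprayCoeff hU hdet k).differentiableAt_fiber hx hy)

theorem sum_berwaldConn_mul (hU : IsOpen U) (hF : SlitSmooth U F)
    (hhom : ∀ x, PosHom 1 (F x))
    (hdet : ∀ x ∈ U, ∀ y : E n, y ≠ 0 → (fundamentalTensor F x y).det ≠ 0)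
    {x y : E n} (hx : x ∈ U) (hy : y ≠ 0) (k i : Fin n) :
    ∑ j, berwaldConn F x y k i j * y j = nonlinearConn F x y k i := by
  have h := ((posHom_sprayCoeff hhom x k).pd_apply i).sum_pd
    (((hF.sprayCoeff hU hdet k).pd_fiber hU i).differentiableAt_fiber hx hy)
  rw [Nat.cast_one, one_mul] at h
  exact h

theorem sum_lowerIndex_mul (hU : IsOpen U) (hF : SlitSmooth U F) (hhom : ∀ x, PosHom 1 (F x))
    (V : E n → E n) {x y : E n} (hx : x ∈ U) (hy : y ≠ 0) :
    ∑ i, lowerIndex F V x y i * y i = ∑ m, (1 / 2) * pd m (fun w => F x w ^ 2) y * V x m := by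
  simp only [← sum_mul_fundamentalTensor hU hF hhom hx hy, lowerIndex, Finset.sum_mul]
  rw [Finset.sum_comm]
  exact Finset.sum_congr rfl fun _ _ => Finset.sum_congr rfl fun _ _ => by ring

theorem contDiffOn_coord {V : E n → E n} (hV : ContDiffOn ℝ ∞ V U) (m : Fin n) :
    ContDiffOn ℝ ∞ (fun x => V x m) U := by
  fun_prop

theorem SlitSmooth.lowerIndex (hU : IsOpen U) (hF : SlitSmooth U F) {V : E n → E n}
    (hV : ContDiffOn ℝ ∞ V U) (i : Fin n) : SlitSmooth U fun x y => lowerIndex F V x y i :=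
  SlitSmooth.sum fun m _ =>
    (hF.fundamentalTensor hU i m).mul (SlitSmooth.of_base hU (contDiffOn_coord hV m))

theorem pd_sum {ι : Type*} {s : Finset ι} {φ : ι → E n → ℝ} {z : E n} (k : Fin n)
    (h : ∀ i ∈ s, DifferentiableAt ℝ (φ i) z) :
    pd k (fun u => ∑ i ∈ s, φ i u) z = ∑ i ∈ s, pd k (φ i) z := by
  simp [pd, fderiv_fun_sum h]

theorem pd_mul {φ ψ : E n → ℝ} {z : E n} (k : Fin n) (hφ : DifferentiableAt ℝ φ z)
    (hψ : DifferentiableAt ℝ ψ z) :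
    pd k (fun u => φ u * ψ u) z = pd k φ z * ψ z + φ z * pd k ψ z := by
  simp only [pd, fderiv_fun_mul hφ hψ, add_apply, smul_apply, smul_eq_mul]
  ring

theorem pd_congr {φ ψ : E n → ℝ} {z : E n} (k : Fin n) (h : φ =ᶠ[𝓝 z] ψ) :
    pd k φ z = pd k ψ z := by
  rw [pd, pd, h.fderiv_eq]

theorem pd_coord (k i : Fin n) (z : E n) :
    pd k (fun u : E n => u i) z = if k = i then 1 else 0 := by
  have : fderiv ℝ (fun u : E n => u i) z = EuclideanSpace.proj i :=
    (EuclideanSpace.proj (𝕜 := ℝ) i).hasFDerivAt.fderiv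
  rw [pd, this]
  simp [eq_comm]

/-- Along the geodesic spray, `V_{0|0}` is the derivative of the momentum `½ [F²]_{yᵐ} Vᵐ`: the
contractions with `y` collapse the connection coefficients by Euler's theorem. -/
theorem V00_eq_spray (hU : IsOpen U) (hF : SlitSmooth U F) (hhom : ∀ x, PosHom 1 (F x))
    (hdet : ∀ x ∈ U, ∀ y : E n, y ≠ 0 → (fundamentalTensor F x y).det ≠ 0)
    {V : E n → E n} (hV : ContDiffOn ℝ ∞ V U) {x y : E n} (hx : x ∈ U) (hy : y ≠ 0) :
    V00 F V x y =
      ∑ j, pd j (fun u => ∑ m, (1 / 2) * pd m (fun w => F u w ^ 2) y * V u m) x * y j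
      - 2 * ∑ k, sprayCoeff F x y k *
        pd k (fun v => ∑ m, (1 / 2) * pd m (fun w => F x w ^ 2) v * V x m) y := by
  have hlow := hF.lowerIndex hU hV
  have h1 (j : Fin n) : pd j (fun u => ∑ m, (1 / 2) * pd m (fun w => F u w ^ 2) y * V u m) x
      = ∑ i, pd j (fun u => lowerIndex F V u y i) x * y i := by
    have he : (fun u => ∑ m, (1 / 2) * pd m (fun w => F u w ^ 2) y * V u m) =ᶠ[𝓝 x]
        fun u => ∑ i, lowerIndex F V u y i * y i := by
      filter_upwards [hU.mem_nhds hx] with u hu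
      exact (sum_lowerIndex_mul hU hF hhom V hu hy).symm
    rw [pd_congr j he, pd_sum]
    · refine Finset.sum_congr rfl fun i _ => ?_
      rw [pd_mul j ((hlow i).differentiableAt_base hx hy) (differentiableAt_const _)]
      simp [pd]
    · exact fun i _ => ((hlow i).differentiableAt_base hx hy).mul_const _
  have h2 (k : Fin n) : pd k (fun v => ∑ m, (1 / 2) * pd m (fun w => F x w ^ 2) v * V x m) y
      = ∑ i, pd k (fun v => lowerIndex F V x v i) y * y i + lowerIndex F V x y k := by
    have he : (fun v => ∑ m, (1 / 2) * pd m (fun w => F x w ^ 2) v * V x m) =ᶠ[𝓝 y]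
        fun v => ∑ i, lowerIndex F V x v i * v i := by
      filter_upwards [isOpen_ne.mem_nhds hy] with v hv
      exact (sum_lowerIndex_mul hU hF hhom V hx hv).symm
    have hc (i : Fin n) : DifferentiableAt ℝ (fun v : E n => v i) y := by fun_prop
    rw [pd_congr k he, pd_sum]
    · simp_rw [pd_mul k ((hlow _).differentiableAt_fiber hx hy) (hc _), pd_coord]
      simp [Finset.sum_add_distrib]
    · exact fun i _ => ((hlow i).differentiableAt_fiber hx hy).mul (hc i)
  have e1 : ∑ i, ∑ j, pd j (fun u => lowerIndex F V u y i) x * y i * y j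
      = ∑ j, pd j (fun u => ∑ m, (1 / 2) * pd m (fun w => F u w ^ 2) y * V u m) x * y j := by
    rw [Finset.sum_comm]
    simp only [h1, Finset.sum_mul]
  have e2 : ∑ i, ∑ j, (∑ k, nonlinearConn F x y k j * pd k (fun v => lowerIndex F V x v i) y)
        * y i * y j
      = ∑ k, 2 * sprayCoeff F x y k * ∑ i, pd k (fun v => lowerIndex F V x v i) y * y i := by
    simp only [← sum_nonlinearConn_mul hU hF hhom hdet hx hy, Finset.mul_sum, Finset.sum_mul]
    conv_lhs => enter [2, i]; rw [Finset.sum_comm]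
    rw [Finset.sum_comm]
    exact Finset.sum_congr rfl fun _ _ => Finset.sum_congr rfl fun _ _ =>
      Finset.sum_congr rfl fun _ _ => by ring
  have e3 : ∑ i, ∑ j, (∑ k, berwaldConn F x y k i j * lowerIndex F V x y k) * y i * y j
      = ∑ k, 2 * sprayCoeff F x y k * lowerIndex F V x y k := by
    simp only [← sum_nonlinearConn_mul hU hF hhom hdet hx hy,
      ← sum_berwaldConn_mul hU hF hhom hdet hx hy, Finset.sum_mul]
    conv_lhs => enter [2, i]; rw [Finset.sum_comm]
    rw [Finset.sum_comm]
    exact Finset.sum_congr rfl fun _ _ => Finset.sum_congr rfl fun _ _ =>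
      Finset.sum_congr rfl fun _ _ => by ring
  have e0 : V00 F V x y = ∑ i, ∑ j, pd j (fun u => lowerIndex F V u y i) x * y i * y j
      - ∑ i, ∑ j, (∑ k, nonlinearConn F x y k j * pd k (fun v => lowerIndex F V x v i) y)
        * y i * y j
      - ∑ i, ∑ j, (∑ k, berwaldConn F x y k i j * lowerIndex F V x y k) * y i * y j := by
    simp only [V00, horizontalDeriv, sub_mul, Finset.sum_sub_distrib]
  rw [e0, e1, e2, e3, sub_sub, ← Finset.sum_add_distrib, Finset.mul_sum]
  congr 1
  exact Finset.sum_congr rfl fun k _ => by rw [h2]; ring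

/-- Noether's identity: `V_{0|0} = F · V^c(F)`, where `V^c = Vⁱ ∂_{xⁱ} + yʲ (∂_j Vⁱ) ∂_{yⁱ}` is the
complete lift of `V`. -/
theorem V00_eq_completeLift (hU : IsOpen U) (hF : SlitSmooth U F) (hhom : ∀ x, PosHom 1 (F x))
    (hdet : ∀ x ∈ U, ∀ y : E n, y ≠ 0 → (fundamentalTensor F x y).det ≠ 0)
    {V : E n → E n} (hV : ContDiffOn ℝ ∞ V U) {x y : E n} (hx : x ∈ U) (hy : y ≠ 0) :
    V00 F V x y =
      F x y * (fderiv ℝ (fun u => F u y) x (V x) + fderiv ℝ (F x) y (fderiv ℝ V x y)) := by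
  have hF2 := hF.pow 2
  have hVx : DifferentiableAt ℝ V x := (hV.contDiffAt (hU.mem_nhds hx)).differentiableAt (by simp)
  have hVm (m : Fin n) : DifferentiableAt ℝ (fun u => V u m) x := by fun_prop
  have hVp (m j : Fin n) : pd j (fun u => V u m) x
      = fderiv ℝ V x (EuclideanSpace.single j 1) m := by
    have := ((EuclideanSpace.proj (𝕜 := ℝ) m).hasFDerivAt.comp x hVx.hasFDerivAt).fderiv
    have h' : fderiv ℝ (fun u => V u m) x = _ := this
    rw [pd, h']
    rfl
  have h1 (j : Fin n) : pd j (fun u => ∑ m, (1 / 2) * pd m (fun w => F u w ^ 2) y * V u m) x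
      = ∑ m, (1 / 2) * (pd j (fun u => pd m (fun w => F u w ^ 2) y) x * V x m
        + pd m (fun w => F x w ^ 2) y * fderiv ℝ V x (EuclideanSpace.single j 1) m) := by
    have hd (m : Fin n) := ((hF2.pd_fiber hU m).differentiableAt_base hx hy)
    rw [pd_sum]
    · refine Finset.sum_congr rfl fun m _ => ?_
      rw [pd_mul j ((hd m).const_mul _) (hVm m), pd_mul j (differentiableAt_const _) (hd m), hVp]
      simp only [pd, fderiv_const_apply, zero_apply]
      ring
    · exact fun m _ => ((hd m).const_mul _).mul (hVm m)
  have h2 (k : Fin n) : pd k (fun v => ∑ m, (1 / 2) * pd m (fun w => F x w ^ 2) v * V x m) y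
      = ∑ m, fundamentalTensor F x y k m * V x m := by
    have hd (m : Fin n) := ((hF2.pd_fiber hU m).differentiableAt_fiber hx hy)
    rw [pd_sum]
    · refine Finset.sum_congr rfl fun m _ => ?_
      rw [pd_mul k ((hd m).const_mul _) (differentiableAt_const _),
        pd_mul k (differentiableAt_const _) (hd m), fundamentalTensor_apply]
      simp only [pd, fderiv_const_apply, zero_apply]
      ring
    · exact fun m _ => ((hd m).const_mul _).mul_const _
  -- the geodesic equation, contracted with `V`
  have h3 : ∑ k, sprayCoeff F x y k * ∑ m, fundamentalTensor F x y k m * V x m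
      = ∑ m, (1 / 4) * ((∑ k, pd k (fun u => pd m (fun w => F u w ^ 2) y) x * y k)
        - pd m (fun u => F u y ^ 2) x) * V x m := by
    simp only [← sum_fundamentalTensor_mul_sprayCoeff (hdet x hx y hy), Finset.mul_sum,
      Finset.sum_mul]
    rw [Finset.sum_comm]
    refine Finset.sum_congr rfl fun m _ => Finset.sum_congr rfl fun k _ => ?_
    rw [fundamentalTensor_symm hF hx hy k m]
    ring
  have h4 : ∑ m, pd m (fun u => F u y ^ 2) x * V x m
      = 2 * F x y * fderiv ℝ (fun u => F u y) x (V x) := by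
    rw [sum_pd_mul, fderiv_fun_pow 2 (hF.differentiableAt_base hx hy)]
    simp
  have h5 : ∑ j, ∑ m, pd m (fun w => F x w ^ 2) y * fderiv ℝ V x (EuclideanSpace.single j 1) m
      * y j = 2 * F x y * fderiv ℝ (F x) y (fderiv ℝ V x y) := by
    have : ∀ m, ∑ j, fderiv ℝ V x (EuclideanSpace.single j 1) m * y j = fderiv ℝ V x y m := by
      intro m
      have hproj : fderiv ℝ (fun u => V u m) x = (EuclideanSpace.proj m).comp (fderiv ℝ V x) :=
        ((EuclideanSpace.proj (𝕜 := ℝ) m).hasFDerivAt.comp x hVx.hasFDerivAt).fderiv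
      simp only [← hVp, sum_pd_mul, hproj]
      rfl
    rw [Finset.sum_comm]
    simp only [mul_assoc, ← Finset.mul_sum, this]
    rw [sum_pd_mul, fderiv_fun_pow 2 (hF.differentiableAt_fiber hx hy)]
    simp [mul_assoc]
  have h6 : ∑ m, (∑ k, pd k (fun u => pd m (fun w => F u w ^ 2) y) x * y k) * V x m
      = ∑ j, ∑ m, pd j (fun u => pd m (fun w => F u w ^ 2) y) x * V x m * y j := by
    simp only [Finset.sum_mul]
    rw [Finset.sum_comm]
    exact Finset.sum_congr rfl fun _ _ => Finset.sum_congr rfl fun _ _ => by ring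
  have h7 : ∑ j, pd j (fun u => ∑ m, (1 / 2) * pd m (fun w => F u w ^ 2) y * V u m) x * y j
      = (1 / 2) * ∑ m, (∑ k, pd k (fun u => pd m (fun w => F u w ^ 2) y) x * y k) * V x m
        + (1 / 2) * (2 * F x y * fderiv ℝ (F x) y (fderiv ℝ V x y)) := by
    rw [h6, ← h5, Finset.mul_sum, Finset.mul_sum, ← Finset.sum_add_distrib]
    refine Finset.sum_congr rfl fun j _ => ?_
    rw [h1, Finset.sum_mul, Finset.mul_sum, Finset.mul_sum, ← Finset.sum_add_distrib]
    exact Finset.sum_congr rfl fun m _ => by ring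
  have h8 : ∑ m, (1 / 4) * ((∑ k, pd k (fun u => pd m (fun w => F u w ^ 2) y) x * y k)
        - pd m (fun u => F u y ^ 2) x) * V x m
      = (1 / 4) * ∑ m, (∑ k, pd k (fun u => pd m (fun w => F u w ^ 2) y) x * y k) * V x m
        - (1 / 4) * (2 * F x y * fderiv ℝ (fun u => F u y) x (V x)) := by
    rw [← h4, Finset.mul_sum, Finset.mul_sum, ← Finset.sum_sub_distrib]
    exact Finset.sum_congr rfl fun m _ => by ring
  rw [V00_eq_spray hU hF hhom hdet hV hx hy, h7]
  simp only [h2]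
  rw [h3, h8]
  ring

/-- The Euler–Lagrange expression `F_{xᵏyˡ} yᵏ vˡ - F_{xˡ} vˡ` of `F` in the direction `v`. -/
def eulerLagrange (F : E n → E n → ℝ) (x y v : E n) : ℝ :=
  fderiv ℝ (fun u => fderiv ℝ (F u) y v) x y - fderiv ℝ (fun u => F u y) x v

/-- The vertical Hessian `F_{yˡyᵐ} vˡ wᵐ`. -/
def verticalHessian (F : E n → E n → ℝ) (x y v w : E n) : ℝ :=
  fderiv ℝ (fun z => fderiv ℝ (F x) z v) y w

theorem fundamentalTensor_eq (hF : SlitSmooth U F) (hU : IsOpen U) {x y : E n} (hx : x ∈ U)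
    (hy : y ≠ 0) (i j : Fin n) :
    fundamentalTensor F x y i j = pd i (F x) y * pd j (F x) y
      + F x y * verticalHessian F x y (EuclideanSpace.single j 1) (EuclideanSpace.single i 1) := by
  have he : (fun v => pd j (fun w => F x w ^ 2) v) =ᶠ[𝓝 y] fun v => 2 * F x v * pd j (F x) v := by
    filter_upwards [isOpen_ne.mem_nhds hy] with v hv
    rw [pd, fderiv_fun_pow 2 (hF.differentiableAt_fiber hx hv)]
    simp [pd]
  have hd := hF.differentiableAt_fiber hx hy
  rw [fundamentalTensor_apply, pd_congr i he,
    pd_mul i (hd.const_mul 2) ((hF.pd_fiber hU j).differentiableAt_fiber hx hy),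
    pd_mul i (differentiableAt_const _) hd]
  simp only [pd, fderiv_const_apply, zero_apply, verticalHessian]
  ring

/-- If the Euler–Lagrange covector of `F` is `F_{yˡyᵐ} wᵐ`, then the spray is `Gⁱ = ½ wⁱ + P yⁱ`. -/
theorem sprayCoeff_of_eulerLagrange (hU : IsOpen U) (hF : SlitSmooth U F)
    (hhom : ∀ x, PosHom 1 (F x)) {x y : E n} (hx : x ∈ U) (hy : y ≠ 0) (hpos : F x y ≠ 0)
    (hdet : (fundamentalTensor F x y).det ≠ 0) (w : E n)
    (hw : ∀ v, eulerLagrange F x y v = verticalHessian F x y v w) (i : Fin n) :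
    sprayCoeff F x y i = (1 / 2) * w i
      + (fderiv ℝ (fun u => F u y) x y - fderiv ℝ (F x) y w) / (2 * F x y) * y i := by
  set P := (fderiv ℝ (fun u => F u y) x y - fderiv ℝ (F x) y w) / (2 * F x y) with hP
  have hd := hF.differentiableAt_fiber hx hy
  -- the fundamental tensor applied to a vector
  have hg (z : E n) (l : Fin n) : ∑ i, fundamentalTensor F x y l i * z i
      = pd l (F x) y * fderiv ℝ (F x) y z
        + F x y * verticalHessian F x y (EuclideanSpace.single l 1) z := by
    simp only [fundamentalTensor_symm hF hx hy l, fundamentalTensor_eq hF hU hx hy, add_mul,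
      Finset.sum_add_distrib, verticalHessian]
    rw [← sum_pd_mul _ y z, ← sum_pd_mul _ y z, Finset.mul_sum, Finset.mul_sum]
    congr 1
    · exact Finset.sum_congr rfl fun _ _ => by ring
    · exact Finset.sum_congr rfl fun _ _ => by rw [pd]; ring
  have hbr (l : Fin n) : (∑ k, pd k (fun u => pd l (fun w => F u w ^ 2) y) x * y k)
        - pd l (fun u => F u y ^ 2) x = 2 * fderiv ℝ (fun u => F u y) x y * pd l (F x) y
          + 2 * F x y * eulerLagrange F x y (EuclideanSpace.single l 1) := by
    have he : (fun u => pd l (fun w => F u w ^ 2) y) =ᶠ[𝓝 x] fun u => 2 * F u y * pd l (F u) y := by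
      filter_upwards [hU.mem_nhds hx] with u hu
      rw [pd, fderiv_fun_pow 2 (hF.differentiableAt_fiber hu hy)]
      simp [pd]
    have hb := hF.differentiableAt_base hx hy
    have hb' := (hF.pd_fiber hU l).differentiableAt_base hx hy
    have h2 : pd l (fun u => F u y ^ 2) x = 2 * F x y * pd l (fun u => F u y) x := by
      rw [pd, fderiv_fun_pow 2 hb]
      simp [pd]
    rw [sum_pd_mul, he.fderiv_eq, fderiv_fun_mul (hb.const_mul 2) hb', fderiv_const_mul hb, h2]
    simp only [add_apply, smul_apply, smul_eq_mul, eulerLagrange, pd]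
    ring
  have hy0 (l : Fin n) : verticalHessian F x y (EuclideanSpace.single l 1) y = 0 := by
    have h := ((hhom x).pd_apply l).euler ((hF.pd_fiber hU l).differentiableAt_fiber hx hy)
    rw [Nat.cast_zero, zero_mul] at h
    exact h
  have hy1 : fderiv ℝ (F x) y y = F x y := by simpa using (hhom x).euler hd
  have key : (fundamentalTensor F x y).mulVec (fun i => sprayCoeff F x y i)
      = (fundamentalTensor F x y).mulVec (fun i => (1 / 2) * w i + P * y i) := by
    funext l
    simp only [Matrix.mulVec, dotProduct]
    rw [sum_fundamentalTensor_mul_sprayCoeff hdet, hbr, hw]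
    have h1 : ∑ i, fundamentalTensor F x y l i * ((1 / 2) * w i + P * y i)
        = (1 / 2) * ∑ i, fundamentalTensor F x y l i * w i
          + P * ∑ i, fundamentalTensor F x y l i * y i := by
      rw [Finset.mul_sum, Finset.mul_sum, ← Finset.sum_add_distrib]
      exact Finset.sum_congr rfl fun _ _ => by ring
    rw [h1, hg, hg, hy0, hy1, hP]
    field_simp
    ring
  have hinj := Matrix.mulVec_injective_of_isUnit
    ((Matrix.isUnit_iff_isUnit_det _).2 (isUnit_iff_ne_zero.2 hdet))
  exact congrFun (hinj key) i

end Finsler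

/-! ### Randers metrics -/

section Randers

variable {n : ℕ} {U : Set (E n)}

theorem fderiv_apply_eq_of_hasDerivAt {φ : E n → ℝ} {z v : E n} {d : ℝ}
    (hφ : DifferentiableAt ℝ φ z) (h : HasDerivAt (fun t : ℝ => φ (z + t • v)) d 0) :
    fderiv ℝ φ z v = d := by
  rw [← hφ.lineDeriv_eq_fderiv]
  exact h.deriv

theorem fderiv_norm_clm (A : E n →L[ℝ] E n) {z : E n} (hz : A z ≠ 0) (v : E n) :
    fderiv ℝ (fun u => ‖A u‖) z v = ⟪A z, A v⟫ / ‖A z‖ := by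
  have hd : DifferentiableAt ℝ (fun u => ‖A u‖) z := A.differentiableAt.norm ℝ hz
  have h1 := (A.hasFDerivAt (x := z)).norm_sq.fderiv
  have h2 := fderiv_fun_pow 2 hd
  have h3 := congrArg (fun L => L v) (h2.symm.trans h1)
  simp only [smul_apply, ContinuousLinearMap.comp_apply, smul_eq_mul, innerSL_apply_apply] at h3
  rw [eq_div_iff (norm_ne_zero_iff.2 hz)]
  simp at h3
  linarith

theorem fderiv_randers (A : E n →L[ℝ] E n) (b : E n →L[ℝ] ℝ) {z : E n} (hz : A z ≠ 0) (v : E n) :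
    fderiv ℝ (fun u => ‖A u‖ + b u) z v = ⟪A z, A v⟫ / ‖A z‖ + b v := by
  rw [fderiv_fun_add (A.differentiableAt.norm ℝ hz) b.differentiableAt, add_apply,
    fderiv_norm_clm A hz, ContinuousLinearMap.fderiv]

theorem verticalHessian_randers {F : E n → E n → ℝ} {x : E n} {A : E n →L[ℝ] E n}
    {b : E n →L[ℝ] ℝ} (hA : ∀ y, y ≠ 0 → A y ≠ 0) (hF : ∀ y, F x y = ‖A y‖ + b y)
    {y : E n} (hy : y ≠ 0) (v w : E n) :
    verticalHessian F x y v w =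
      ⟪A v, A w⟫ / ‖A y‖ - ⟪A y, A v⟫ * ⟪A y, A w⟫ / ‖A y‖ ^ 3 := by
  have he : (fun z => fderiv ℝ (F x) z v) =ᶠ[𝓝 y] fun z => ⟪A z, A v⟫ / ‖A z‖ + b v := by
    filter_upwards [isOpen_ne.mem_nhds hy] with z hz
    rw [show F x = fun u => ‖A u‖ + b u from funext hF, fderiv_randers A b (hA z hz)]
  have hne : ‖A y‖ ≠ 0 := norm_ne_zero_iff.2 (hA y hy)
  have hN : DifferentiableAt ℝ (fun u => ‖A u‖) y := A.differentiableAt.norm ℝ (hA y hy)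
  have hI : HasFDerivAt (fun z => ⟪A z, A v⟫) ((innerSL ℝ (A v)).comp A) y := by
    have := ((innerSL ℝ (A v)).comp A).hasFDerivAt (x := y)
    refine this.congr_of_eventuallyEq (Eventually.of_forall fun z => ?_)
    exact real_inner_comm _ _
  have hN' : DifferentiableAt ℝ (fun u => ‖A u‖⁻¹) y := hN.inv hne
  have hd : DifferentiableAt ℝ (fun z => ⟪A z, A v⟫ / ‖A z‖) y  := by
    simpa only [div_eq_mul_inv] using hI.differentiableAt.fun_mul hN'
  -- differentiate the product of the quotient with its denominator
  have h1 : (fun z => (⟪A z, A v⟫ / ‖A z‖) * ‖A z‖) =ᶠ[𝓝 y] fun z => ⟪A z, A v⟫ := by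
    filter_upwards [isOpen_ne.mem_nhds hy] with z hz
    exact div_mul_cancel₀ _ (norm_ne_zero_iff.2 (hA z hz))
  have h2 := congrArg (fun L => L w) (h1.fderiv_eq (𝕜 := ℝ))
  rw [fderiv_fun_mul hd hN, hI.fderiv] at h2
  simp only [add_apply, smul_apply, smul_eq_mul, fderiv_norm_clm A (hA y hy),
    ContinuousLinearMap.comp_apply, innerSL_apply_apply] at h2
  rw [verticalHessian, he.fderiv_eq, fderiv_add_const]
  field_simp at h2 ⊢
  linarith

/-- A Randers norm `‖A y‖ + b y` with `b y < ‖A y‖` is strongly convex: its fundamental tensor is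
nonsingular. -/
theorem det_fundamentalTensor_randers_ne_zero (hU : IsOpen U) {F : E n → E n → ℝ}
    (hsm : SlitSmooth U F) {x : E n} (hx : x ∈ U) {A : E n →L[ℝ] E n}
    {b : E n →L[ℝ] ℝ} (hA : ∀ y, y ≠ 0 → A y ≠ 0) (hb : ∀ y, y ≠ 0 → b y < ‖A y‖)
    (hF : ∀ y, F x y = ‖A y‖ + b y) {y : E n} (hy : y ≠ 0) :
    (fundamentalTensor F x y).det ≠ 0 := by
  intro hdet
  obtain ⟨v', hv', hgv⟩ := Matrix.exists_mulVec_eq_zero_iff.2 hdet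
  set v : E n := WithLp.toLp 2 v' with hv
  have hv0 : v ≠ 0 := fun h => hv' (by simpa [hv] using h)
  have hpos : 0 < F x y := by
    have := hb (-y) (neg_ne_zero.2 hy)
    rw [map_neg, map_neg, norm_neg] at this
    rw [hF]
    linarith
  -- a null vector `v` of `g` has `(F_y v)² + F F_yy(v,v) = 0`, a sum of nonnegative terms
  have hquad : fderiv ℝ (F x) y v ^ 2 + F x y * verticalHessian F x y v v = 0 := by
    have h0 : ∑ j, (∑ i, fundamentalTensor F x y j i * v i) * v j = 0 :=
      Finset.sum_eq_zero fun j _ => by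
        have := congrFun hgv j
        simp only [Matrix.mulVec, dotProduct, Pi.zero_apply] at this
        rw [hv, this, zero_mul]
    rw [← h0]
    have hdy := hsm.fiber hx hy
    have h1 (j : Fin n) : ∑ i, fundamentalTensor F x y j i * v i
        = pd j (F x) y * fderiv ℝ (F x) y v
          + F x y * pd j (fun z => fderiv ℝ (F x) z v) y := by
      rw [pd, pd, fderiv_fderiv_comm hdy, ← sum_pd_mul _ y v, ← sum_pd_mul _ y v, Finset.mul_sum,
        Finset.mul_sum, ← Finset.sum_add_distrib]
      refine Finset.sum_congr rfl fun i _ => ?_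
      rw [fundamentalTensor_symm hsm hx hy, fundamentalTensor_eq hsm hU hx hy, verticalHessian]
      simp only [pd]
      ring
    have h2 := sum_pd_mul (F x) y v
    simp only [h1, verticalHessian, add_mul, Finset.sum_add_distrib, mul_assoc, ← Finset.mul_sum,
      sum_pd_mul]
    have h3 : ∑ i, pd i (F x) y * (fderiv ℝ (F x) y v * v i) = fderiv ℝ (F x) y v ^ 2 := by
      rw [sq, ← h2, Finset.sum_mul]
      exact Finset.sum_congr rfl fun i _ => by rw [h2]; ring
    rw [h3]
  have hAy : 0 < ‖A y‖ := norm_pos_iff.2 (hA y hy)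
  have hH : verticalHessian F x y v v = (‖A v‖ ^ 2 * ‖A y‖ ^ 2 - ⟪A y, A v⟫ ^ 2) / ‖A y‖ ^ 3 := by
    rw [verticalHessian_randers hA hF hy, real_inner_self_eq_norm_sq]
    field_simp
  have hcs : ⟪A y, A v⟫ ^ 2 ≤ ‖A v‖ ^ 2 * ‖A y‖ ^ 2 := by
    have h := abs_real_inner_le_norm (A y) (A v)
    have := sq_le_sq' (by linarith [neg_abs_le ⟪A y, A v⟫]) ((le_abs_self _).trans h)
    nlinarith
  have hHn : 0 ≤ verticalHessian F x y v v := by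
    rw [hH]
    exact div_nonneg (by linarith) (by positivity)
  have hH0 : verticalHessian F x y v v = 0 := by
    have : F x y * verticalHessian F x y v v = 0 := by
      nlinarith [sq_nonneg (fderiv ℝ (F x) y v), mul_nonneg hpos.le hHn]
    exact (mul_eq_zero.1 this).resolve_left hpos.ne'
  have hd0 : fderiv ℝ (F x) y v = 0 := by
    rw [hH0, mul_zero, add_zero] at hquad
    exact pow_eq_zero_iff two_ne_zero |>.1 hquad
  -- equality in Cauchy–Schwarz: `v` is a multiple of `y`, on which `F_y` does not vanish
  have hpar : ‖A y‖ ^ 2 • A v = ⟪A y, A v⟫ • A y := by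
    have h1 : ‖A v‖ ^ 2 * ‖A y‖ ^ 2 - ⟪A y, A v⟫ ^ 2 = 0 := by
      rw [hH, div_eq_zero_iff] at hH0
      exact hH0.resolve_right (by positivity)
    rw [← sub_eq_zero, ← norm_eq_zero, ← sq_eq_zero_iff, norm_sub_sq_real, norm_smul, norm_smul,
      real_inner_smul_left, real_inner_smul_right, real_inner_comm (A y) (A v)]
    simp only [Real.norm_eq_abs, mul_pow, sq_abs]
    linear_combination ‖A y‖ ^ 2 * h1
  have hv' : ‖A y‖ ^ 2 • v = ⟪A y, A v⟫ • y := by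
    by_contra hne
    refine hA _ (sub_ne_zero.2 hne) ?_
    rw [map_sub, map_smul, map_smul, hpar, sub_self]
  have hE : fderiv ℝ (F x) y y = F x y := by
    rw [show F x = fun u => ‖A u‖ + b u from funext hF, fderiv_randers A b (hA y hy),
      real_inner_self_eq_norm_sq]
    field_simp
  have h3 := congrArg (fderiv ℝ (F x) y) hv'
  rw [map_smul, map_smul, hd0, hE, smul_zero, smul_eq_mul, eq_comm, mul_eq_zero] at h3
  rw [h3.resolve_right hpos.ne', zero_smul] at hv'
  exact (smul_ne_zero (by positivity) hv0) hv'

theorem slitSmooth_clm (hU : IsOpen U) {β : E n → E n →L[ℝ] ℝ} (hβ : ContDiffOn ℝ ∞ β U) :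
    SlitSmooth U fun x y => β x y := fun x hx _ _ =>
  ((hβ.contDiffAt (hU.mem_nhds hx)).comp (x, _) contDiffAt_fst).clm_apply contDiffAt_snd

theorem eulerLagrange_add (hU : IsOpen U) {f g : E n → E n → ℝ} (hf : SlitSmooth U f)
    (hg : SlitSmooth U g) {x y : E n} (hx : x ∈ U) (hy : y ≠ 0) (v : E n) :
    eulerLagrange (fun x y => f x y + g x y) x y v
      = eulerLagrange f x y v + eulerLagrange g x y v := by
  have he : (fun u => fderiv ℝ (fun y => f u y + g u y) y v) =ᶠ[𝓝 x]
      fun u => fderiv ℝ (f u) y v + fderiv ℝ (g u) y v := by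
    filter_upwards [hU.mem_nhds hx] with u hu
    rw [fderiv_fun_add (hf.differentiableAt_fiber hu hy) (hg.differentiableAt_fiber hu hy)]
    rfl
  simp only [eulerLagrange]
  rw [he.fderiv_eq, fderiv_fun_add ((hf.fderiv_fiber hU v).differentiableAt_base hx hy)
    ((hg.fderiv_fiber hU v).differentiableAt_base hx hy),
    fderiv_fun_add (hf.differentiableAt_base hx hy) (hg.differentiableAt_base hx hy)]
  simp only [add_apply]
  ring

/-- The Euler–Lagrange expression of a closed form `f(c) dc` vanishes. -/
theorem eulerLagrange_closed {f : ℝ → ℝ} {c : E n → ℝ} {x : E n} (hc : ContDiffAt ℝ ∞ c x)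
    (hf : DifferentiableAt ℝ f (c x)) (y v : E n) :
    eulerLagrange (fun u z => (f (c u) • fderiv ℝ c u) z) x y v = 0 := by
  have hd : DifferentiableAt ℝ (fun u => f (c u)) x :=
    hf.comp x (hc.differentiableAt (by simp))
  have hcd (a : E n) : DifferentiableAt ℝ (fun u => fderiv ℝ c u a) x :=
    ((hc.fderiv_right (m := ∞) (by simp)).clm_apply contDiffAt_const).differentiableAt (by simp)
  have h1 : fderiv ℝ (fun u => f (c u)) x = deriv f (c x) • fderiv ℝ c x := by
    have := (hf.hasDerivAt.comp_hasFDerivAt x (hc.differentiableAt (by simp)).hasFDerivAt).fderiv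
    exact this
  simp only [eulerLagrange, ContinuousLinearMap.fderiv]
  simp only [smul_apply, smul_eq_mul]
  rw [fderiv_fun_mul hd (hcd v), fderiv_fun_mul hd (hcd y), h1]
  simp only [add_apply, smul_apply, smul_eq_mul]
  rw [fderiv_fderiv_comm hc v y]
  ring

end Randers

/-! ### The metric `2|y| / (1 + μ|x|²)`, the factor `c` and the field `V` -/

section Model

variable {n : ℕ}

theorem hasDerivAt_line (x v : E n) : HasDerivAt (fun t : ℝ => x + t • v) v 0 := by
  simpa using ((hasDerivAt_id (0 : ℝ)).smul_const v).const_add x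

theorem hasDerivAt_inner_line (a x v : E n) :
    HasDerivAt (fun t : ℝ => ⟪a, x + t • v⟫) ⟪a, v⟫ 0 := by
  simpa using (hasDerivAt_const (0 : ℝ) a).inner ℝ (hasDerivAt_line x v)

theorem hasDerivAt_norm_sq_line (x v : E n) :
    HasDerivAt (fun t : ℝ => ‖x + t • v‖ ^ 2) (2 * ⟪x, v⟫) 0 := by
  simpa using (hasDerivAt_line x v).norm_sq

theorem inner_toEuclideanLin_of_skew {Q : Matrix (Fin n) (Fin n) ℝ} (hQ : Q.transpose = -Q)
    (u v : E n) : ⟪u, Matrix.toEuclideanLin Q v⟫ = -⟪Matrix.toEuclideanLin Q u, v⟫ := by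
  have h : Q.conjTranspose = -Q := by rw [← hQ]; ext; simp
  rw [← LinearMap.adjoint_inner_left, ← Matrix.toEuclideanLin_conjTranspose_eq_adjoint, h, map_neg,
    LinearMap.neg_apply, inner_neg_left]

theorem contDiffAt_factor {μ τ : ℝ} {η γ x : E n} (hD : 1 + μ * ‖x‖ ^ 2 ≠ 0) :
    ContDiffAt ℝ ∞ (factor μ τ η γ) x := by
  have h1 : ContDiffAt ℝ ∞ (fun x : E n => ‖x‖ ^ 2) x := contDiffAt_id.norm_sq ℝ
  have h2 : ContDiffAt ℝ ∞ (fun x : E n => ⟪μ • γ + η, x⟫) x :=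
    contDiffAt_const.inner ℝ contDiffAt_id
  exact ContDiffAt.div ((contDiffAt_const.mul (contDiffAt_const.sub (contDiffAt_const.mul h1))).add
    h2) (contDiffAt_const.add (contDiffAt_const.mul h1)) hD

theorem fderiv_factor {μ τ : ℝ} {η γ x : E n} (hD : 1 + μ * ‖x‖ ^ 2 ≠ 0) (v : E n) :
    fderiv ℝ (factor μ τ η γ) x v =
      ((⟪μ • γ + η, v⟫ - 2 * τ * μ * ⟪x, v⟫) * (1 + μ * ‖x‖ ^ 2)
        - (τ * (1 - μ * ‖x‖ ^ 2) + ⟪μ • γ + η, x⟫) * (2 * μ * ⟪x, v⟫)) / (1 + μ * ‖x‖ ^ 2) ^ 2 := by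
  refine fderiv_apply_eq_of_hasDerivAt ((contDiffAt_factor hD).differentiableAt (by simp)) ?_
  have h1 := hasDerivAt_norm_sq_line x v
  have h := ((((h1.const_mul μ).const_sub 1).const_mul τ).add
    (hasDerivAt_inner_line (μ • γ + η) x v)).div ((h1.const_mul μ).const_add 1) (by simpa using hD)
  refine h.congr_deriv ?_
  simp
  ring

theorem fderiv_alphaMu_base {μ : ℝ} {x : E n} (hD : 1 + μ * ‖x‖ ^ 2 ≠ 0) (y v : E n) :
    fderiv ℝ (fun u => alphaMu μ u y) x v
      = -(4 * μ * ⟪x, v⟫ / (1 + μ * ‖x‖ ^ 2) ^ 2) * ‖y‖ := by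
  have h0 : ContDiffAt ℝ ∞ (fun x : E n => ‖x‖ ^ 2) x := contDiffAt_id.norm_sq ℝ
  have hs : ContDiffAt ℝ ∞ (fun u => alphaMu μ u y) x :=
    (contDiffAt_const.div (contDiffAt_const.add (contDiffAt_const.mul h0)) hD).mul contDiffAt_const
  refine fderiv_apply_eq_of_hasDerivAt (hs.differentiableAt (by simp)) ?_
  have h := ((hasDerivAt_const (0 : ℝ) (2 : ℝ)).div
    (((hasDerivAt_norm_sq_line x v).const_mul μ).const_add 1) (by simpa using hD)).mul_const ‖y‖
  refine h.congr_deriv ?_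
  simp
  ring

/-- The frame `2/(1+μ|x|²) • id`, which turns `α` into the Euclidean norm. -/
def scaling (μ : ℝ) (x : E n) : E n →L[ℝ] E n :=
  (2 / (1 + μ * ‖x‖ ^ 2)) • ContinuousLinearMap.id ℝ (E n)

theorem scaling_apply (μ : ℝ) (x y : E n) :
    scaling μ x y = (2 / (1 + μ * ‖x‖ ^ 2)) • y := rfl

theorem norm_scaling {μ : ℝ} {x : E n} (hD : 0 < 1 + μ * ‖x‖ ^ 2) (y : E n) :
    ‖scaling μ x y‖ = alphaMu μ x y := by
  rw [scaling_apply, norm_smul, Real.norm_of_nonneg (by positivity), alphaMu]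

theorem scaling_ne_zero {μ : ℝ} {x : E n} (hD : 0 < 1 + μ * ‖x‖ ^ 2) {y : E n} (hy : y ≠ 0) :
    scaling μ x y ≠ 0 := by
  rw [scaling_apply]
  exact smul_ne_zero (by positivity) hy

theorem slitSmooth_alphaMu {μ : ℝ} {U : Set (E n)} (hD : ∀ x ∈ U, 0 < 1 + μ * ‖x‖ ^ 2) :
    SlitSmooth U (alphaMu μ) := by
  intro x hx y hy
  have h1 : ContDiffAt ℝ ∞ (fun p : E n × E n => ‖p.1‖ ^ 2) (x, y) := contDiffAt_fst.norm_sq ℝ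
  have h2 : ContDiffAt ℝ ∞ (fun p : E n × E n => ‖p.2‖) (x, y) := contDiffAt_snd.norm ℝ hy
  exact (contDiffAt_const.div (contDiffAt_const.add (contDiffAt_const.mul h1)) (hD x hx).ne').mul h2

theorem posHom_alphaMu (μ : ℝ) (x : E n) : PosHom 1 (alphaMu μ x) := fun t ht y => by
  rw [alphaMu, alphaMu, norm_smul, Real.norm_of_nonneg ht.le]
  ring

theorem contDiff_fieldV (τ : ℝ) (η γ : E n) (Q : Matrix (Fin n) (Fin n) ℝ) :
    ContDiff ℝ ∞ (fieldV τ η γ Q) := by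
  have h1 : ContDiff ℝ ∞ (fun x : E n => ‖x‖ ^ 2) := contDiff_id.norm_sq ℝ
  have h2 : ContDiff ℝ ∞ (fun x : E n => ⟪η, x⟫) := contDiff_const.inner ℝ contDiff_id
  have h3 : ContDiff ℝ ∞ (fun x : E n => Matrix.toEuclideanLin Q x) :=
    (LinearMap.toContinuousLinearMap (Matrix.toEuclideanLin Q)).contDiff
  exact ((((contDiff_const.mul (contDiff_const.add h2)).smul contDiff_id).add
    (h1.smul contDiff_const)).add h3).add contDiff_const

theorem fderiv_fieldV (τ : ℝ) (η γ : E n) (Q : Matrix (Fin n) (Fin n) ℝ) (x y : E n) :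
    fderiv ℝ (fieldV τ η γ Q) x y = (-2 * ⟪η, y⟫) • x + (-2 * (τ + ⟪η, x⟫)) • y
      + (2 * ⟪x, y⟫) • η + Matrix.toEuclideanLin Q y := by
  rw [← ((contDiff_fieldV τ η γ Q).contDiffAt.differentiableAt (by simp)).lineDeriv_eq_fderiv]
  refine HasDerivAt.deriv ?_
  have hQ : HasDerivAt (fun t : ℝ => Matrix.toEuclideanLin Q (x + t • y))
      (Matrix.toEuclideanLin Q y) 0 :=
    (LinearMap.toContinuousLinearMap (Matrix.toEuclideanLin Q)).hasFDerivAt.comp_hasDerivAt 0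
      (hasDerivAt_line x y)
  have h := (((((hasDerivAt_inner_line η x y).const_add τ).const_mul (-2)).smul
    (hasDerivAt_line x y)).add ((hasDerivAt_norm_sq_line x y).smul_const η)).add hQ |>.add_const γ
  refine h.congr_deriv ?_
  simp only [zero_smul, add_zero]
  abel

/-- `V` is a conformal field of `α` with factor `c`. -/
theorem completeLift_alphaMu {μ τ : ℝ} {η γ : E n} {Q : Matrix (Fin n) (Fin n) ℝ}
    (hQ : Q.transpose = -Q) {x y : E n} (hD : 0 < 1 + μ * ‖x‖ ^ 2) (hy : y ≠ 0) :
    fderiv ℝ (fun u => alphaMu μ u y) x (fieldV τ η γ Q x)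
      + fderiv ℝ (alphaMu μ x) y (fderiv ℝ (fieldV τ η γ Q) x y)
      = -2 * factor μ τ η γ x * alphaMu μ x y := by
  have hα : fderiv ℝ (alphaMu μ x) y (fderiv ℝ (fieldV τ η γ Q) x y)
      = 2 / (1 + μ * ‖x‖ ^ 2) * (⟪y, fderiv ℝ (fieldV τ η γ Q) x y⟫ / ‖y‖) := by
    rw [show alphaMu μ x = fun u => ‖scaling μ x u‖ from funext fun u => (norm_scaling hD u).symm,
      fderiv_norm_clm _ (scaling_ne_zero hD hy), norm_scaling hD, alphaMu]
    simp only [scaling_apply, real_inner_smul_left, real_inner_smul_right]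
    have := norm_ne_zero_iff.2 hy
    field_simp
  have hx0 : ⟪x, Matrix.toEuclideanLin Q x⟫ = 0 := by
    have := inner_toEuclideanLin_of_skew hQ x x
    rw [real_inner_comm] at this
    rw [real_inner_comm]
    linarith
  have hy0 : ⟪y, Matrix.toEuclideanLin Q y⟫ = 0 := by
    have := inner_toEuclideanLin_of_skew hQ y y
    rw [real_inner_comm] at this
    rw [real_inner_comm]
    linarith
  rw [hα, fderiv_alphaMu_base hD.ne', fderiv_fieldV, factor, alphaMu, fieldV]
  simp only [inner_add_right, inner_add_left, real_inner_smul_left, real_inner_smul_right, hx0, hy0,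
    real_inner_self_eq_norm_sq, real_inner_comm x η, real_inner_comm y η, real_inner_comm x γ,
    real_inner_comm y x]
  have := norm_ne_zero_iff.2 hy
  field_simp
  ring

/-- Along `V` the factor `c` obeys the autonomous equation `V(c) = 2τc - 2c² + μ|γ|² + ⟨η,γ⟩`. -/
theorem fderiv_factor_fieldV {μ τ : ℝ} {η γ : E n} {Q : Matrix (Fin n) (Fin n) ℝ}
    (hQ : Q.transpose = -Q)
    (hQη : Matrix.toEuclideanLin Q η = -(μ • ((4 * τ) • γ + Matrix.toEuclideanLin Q γ)))
    (hη : ‖η‖ ^ 2 = μ * (μ * ‖γ‖ ^ 2 - 4 * τ ^ 2)) {x : E n} (hD : 1 + μ * ‖x‖ ^ 2 ≠ 0) :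
    fderiv ℝ (factor μ τ η γ) x (fieldV τ η γ Q x)
      = 2 * τ * factor μ τ η γ x - 2 * factor μ τ η γ x ^ 2 + μ * ‖γ‖ ^ 2 + ⟪η, γ⟫ := by
  have hx0 : ⟪x, Matrix.toEuclideanLin Q x⟫ = 0 := by
    have := inner_toEuclideanLin_of_skew hQ x x
    rw [real_inner_comm] at this
    rw [real_inner_comm]
    linarith
  have ha : μ * ⟪γ, Matrix.toEuclideanLin Q x⟫ + ⟪η, Matrix.toEuclideanLin Q x⟫
      = 4 * μ * τ * ⟪γ, x⟫ := by
    rw [inner_toEuclideanLin_of_skew hQ, inner_toEuclideanLin_of_skew hQ, hQη]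
    simp only [inner_neg_left, real_inner_smul_left, inner_add_left]
    ring
  rw [fderiv_factor hD, factor, fieldV]
  simp only [inner_add_right, inner_add_left, real_inner_smul_left, real_inner_smul_right, hx0,
    real_inner_self_eq_norm_sq, real_inner_comm η γ, real_inner_comm η x,
    real_inner_comm γ x, hη]
  field_simp
  linear_combination (1 + μ * ‖x‖ ^ 2) * ha

/-- The differential equation for `f` says that the Lie derivative of `β = f(c) dc` along `V` is
`-2cβ`. -/
theorem completeLift_betaForm {μ τ : ℝ} {η γ : E n} {Q : Matrix (Fin n) (Fin n) ℝ} {f : ℝ → ℝ}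
    {U : Set (E n)} (hU : IsOpen U) (hD : ∀ x ∈ U, 1 + μ * ‖x‖ ^ 2 ≠ 0)
    (hQ : Q.transpose = -Q)
    (hQη : Matrix.toEuclideanLin Q η = -(μ • ((4 * τ) • γ + Matrix.toEuclideanLin Q γ)))
    (hη : ‖η‖ ^ 2 = μ * (μ * ‖γ‖ ^ 2 - 4 * τ ^ 2)) {x : E n} (hx : x ∈ U)
    (hf : DifferentiableAt ℝ f (factor μ τ η γ x))
    (hode : deriv f (factor μ τ η γ x) * (2 * τ * factor μ τ η γ x - 2 * factor μ τ η γ x ^ 2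
      + μ * ‖γ‖ ^ 2 + ⟪η, γ⟫) = 2 * (factor μ τ η γ x - τ) * f (factor μ τ η γ x)) (y : E n) :
    fderiv ℝ (fun u => betaForm μ τ η γ f u y) x (fieldV τ η γ Q x)
      + betaForm μ τ η γ f x (fderiv ℝ (fieldV τ η γ Q) x y)
      = -2 * factor μ τ η γ x * betaForm μ τ η γ f x y := by
  set c := factor μ τ η γ with hcdef
  set V := fieldV τ η γ Q with hVdef
  have hc : ContDiffAt ℝ ∞ c x := contDiffAt_factor (hD x hx)
  have hcx : DifferentiableAt ℝ c x := hc.differentiableAt (by simp)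
  have hdc : DifferentiableAt ℝ (fderiv ℝ c) x :=
    (hc.fderiv_right (m := ∞) (by simp)).differentiableAt (by simp)
  have hV : DifferentiableAt ℝ V x :=
    (contDiff_fieldV τ η γ Q).contDiffAt.differentiableAt (by simp)
  have h1 : fderiv ℝ (fun u => f (c u)) x = deriv f (c x) • fderiv ℝ c x :=
    (hf.hasDerivAt.comp_hasFDerivAt x hcx.hasFDerivAt).fderiv
  have hcd : DifferentiableAt ℝ (fun u => fderiv ℝ c u y) x :=
    hdc.clm_apply (differentiableAt_const _)
  -- differentiate the autonomous equation for `c`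
  have he : (fun u => fderiv ℝ c u (V u)) =ᶠ[𝓝 x]
      fun u => 2 * τ * c u - 2 * c u ^ 2 + μ * ‖γ‖ ^ 2 + ⟪η, γ⟫ := by
    filter_upwards [hU.mem_nhds hx] with u hu using fderiv_factor_fieldV hQ hQη hη (hD u hu)
  have h2 : fderiv ℝ (fderiv ℝ c) x y (V x) + fderiv ℝ c x (fderiv ℝ V x y)
      = (2 * τ - 4 * c x) * fderiv ℝ c x y := by
    have h3 := congrArg (fun L => L y) (he.fderiv_eq (𝕜 := ℝ))
    rw [fderiv_clm_apply hdc hV, fderiv_add_const, fderiv_add_const,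
      fderiv_fun_sub (hcx.const_mul _) ((hcx.fun_pow 2).const_mul _), fderiv_const_mul hcx,
      fderiv_const_mul (hcx.fun_pow 2), fderiv_fun_pow 2 hcx] at h3
    simp at h3
    linarith
  have h4 : fderiv ℝ (fun u => fderiv ℝ c u y) x (V x) = fderiv ℝ (fderiv ℝ c) x y (V x) := by
    rw [fderiv_fderiv_comm hc, fderiv_clm_apply hdc (differentiableAt_const _)]
    simp
  have h5 : fderiv ℝ c x (V x) = 2 * τ * c x - 2 * c x ^ 2 + μ * ‖γ‖ ^ 2 + ⟪η, γ⟫ :=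
    fderiv_factor_fieldV hQ hQη hη (hD x hx)
  have hfc : DifferentiableAt ℝ (fun u => f (c u)) x := hf.comp x hcx
  have h6 : (fun u => betaForm μ τ η γ f u y) = fun u => f (c u) * fderiv ℝ c u y := rfl
  have h7 (v : E n) : betaForm μ τ η γ f x v = f (c x) * fderiv ℝ c x v := rfl
  rw [h6, h7, h7, fderiv_fun_mul hfc hcd, h1]
  simp only [add_apply, smul_apply, smul_eq_mul, h4, h5]
  linear_combination f (c x) * h2 + fderiv ℝ c x y * hode

theorem eulerLagrange_alphaMu {μ : ℝ} {U : Set (E n)} (hU : IsOpen U)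
    (hD : ∀ x ∈ U, 0 < 1 + μ * ‖x‖ ^ 2) {x y : E n} (hx : x ∈ U) (hy : y ≠ 0) (v : E n) :
    eulerLagrange (alphaMu μ) x y v =
      4 * μ / (1 + μ * ‖x‖ ^ 2) ^ 2 * (⟪x, v⟫ * ‖y‖ - ⟪x, y⟫ * (⟪y, v⟫ / ‖y‖)) := by
  have hy' := norm_ne_zero_iff.2 hy
  have he : (fun u => fderiv ℝ (alphaMu μ u) y v) =ᶠ[𝓝 x]
      fun u => alphaMu μ u y * (⟪y, v⟫ / ‖y‖ ^ 2) := by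
    filter_upwards [hU.mem_nhds hx] with u hu
    have hDu := hD u hu
    rw [show alphaMu μ u = fun z => ‖scaling μ u z‖ from funext fun z => (norm_scaling hDu z).symm,
      fderiv_norm_clm _ (scaling_ne_zero hDu hy)]
    simp only [norm_scaling hDu]
    simp only [alphaMu, scaling_apply, real_inner_smul_left, real_inner_smul_right]
    field_simp
  have hd : DifferentiableAt ℝ (fun u => alphaMu μ u y) x :=
    (slitSmooth_alphaMu hD).differentiableAt_base hx hy
  rw [eulerLagrange, he.fderiv_eq, fderiv_mul_const hd, smul_apply,
    fderiv_alphaMu_base (hD x hx).ne', fderiv_alphaMu_base (hD x hx).ne']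
  have := hD x hx
  simp only [smul_eq_mul]
  field_simp
  ring

end Model

/-! ### The conformal field of an admissible Randers metric -/

section Admissible

variable {n : ℕ} {μ τ : ℝ} {η γ : E n} {Q : Matrix (Fin n) (Fin n) ℝ} {f : ℝ → ℝ} {U : Set (E n)}

theorem IsRandersOn.pos {α : E n → E n → ℝ} {β : E n → E n →L[ℝ] ℝ} (h : IsRandersOn U α β)
    (hα : ∀ x y, α x (-y) = α x y) {x y : E n} (hx : x ∈ U) (hy : y ≠ 0) :
    0 < α x y ∧ 0 < α x y + β x y := by
  have h1 := h.norm_lt_one x hx y hy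
  have h2 := h.norm_lt_one x hx (-y) (neg_ne_zero.2 hy)
  rw [hα, map_neg] at h2
  exact ⟨by linarith, by linarith⟩

theorem alphaMu_neg (μ : ℝ) (x y : E n) : alphaMu μ x (-y) = alphaMu μ x y := by
  rw [alphaMu, alphaMu, norm_neg]

theorem exists_ne_zero (hn : 2 ≤ n) : ∃ y : E n, y ≠ 0 :=
  ⟨EuclideanSpace.single ⟨0, by omega⟩ 1, by simp⟩

/-- The denominator is positive because `α > |β| ≥ 0`. -/
theorem Admissible.denom_pos (hn : 2 ≤ n) (h : Admissible μ τ η γ Q f U) :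
    ∀ x ∈ U, 0 < 1 + μ * ‖x‖ ^ 2 := by
  intro x hx
  obtain ⟨y, hy⟩ := exists_ne_zero hn
  have h1 := (h.isRanders.pos (alphaMu_neg μ) hx hy).1
  by_contra hle
  exact absurd h1 (not_lt.2 (mul_nonpos_of_nonpos_of_nonneg
    (div_nonpos_of_nonneg_of_nonpos two_pos.le (not_lt.1 hle)) (norm_nonneg y)))

theorem Admissible.slitSmooth (hn : 2 ≤ n) (h : Admissible μ τ η γ Q f U) :
    SlitSmooth U (metricF μ τ η γ f) :=
  (slitSmooth_alphaMu (h.denom_pos hn)).add (slitSmooth_clm h.isOpen h.isRanders.smooth)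

theorem posHom_metricF (μ τ : ℝ) (η γ : E n) (f : ℝ → ℝ) (x : E n) :
    PosHom 1 (metricF μ τ η γ f x) := fun t ht y => by
  simp only [metricF, randers, posHom_alphaMu μ x t ht y, map_smul, smul_eq_mul]
  ring

theorem metricF_eq (hD : 0 < 1 + μ * ‖x‖ ^ 2) (y : E n) :
    metricF μ τ η γ f x y = ‖scaling μ x y‖ + betaForm μ τ η γ f x y := by
  rw [norm_scaling hD]; rfl

theorem Admissible.pos (h : Admissible μ τ η γ Q f U) {x y : E n} (hx : x ∈ U) (hy : y ≠ 0) :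
    0 < metricF μ τ η γ f x y := (h.isRanders.pos (alphaMu_neg μ) hx hy).2

theorem Admissible.det_ne_zero (hn : 2 ≤ n) (h : Admissible μ τ η γ Q f U) {x y : E n}
    (hx : x ∈ U) (hy : y ≠ 0) : (fundamentalTensor (metricF μ τ η γ f) x y).det ≠ 0 := by
  have hD := h.denom_pos hn x hx
  refine det_fundamentalTensor_randers_ne_zero h.isOpen (h.slitSmooth hn) hx
    (fun z hz => scaling_ne_zero hD hz) (fun z hz => ?_) (metricF_eq hD) hy
  rw [norm_scaling hD]
  exact h.isRanders.norm_lt_one x hx z hz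

theorem Admissible.isConformalWith (hn : 2 ≤ n) (h : Admissible μ τ η γ Q f U) :
    IsConformalWith U (metricF μ τ η γ f) (fieldV τ η γ Q) (factor μ τ η γ) where
  smooth_field := (contDiff_fieldV τ η γ Q).contDiffOn
  smooth_factor := fun x hx =>
    (contDiffAt_factor (h.denom_pos hn x hx).ne').contDiffWithinAt
  eq := by
    intro x hx y hy
    have hD := h.denom_pos hn
    have hα := slitSmooth_alphaMu hD
    have hβ := slitSmooth_clm h.isOpen h.isRanders.smooth
    obtain ⟨hf, hode⟩ := h.ode _ ⟨x, hx, rfl⟩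
    have h1 := completeLift_alphaMu (τ := τ) (η := η) (γ := γ) h.skew (hD x hx) hy
    have h2 := completeLift_betaForm h.isOpen (fun x hx => (hD x hx).ne') h.skew h.Q_eta h.eta_sq hx
      hf hode y
    rw [V00_eq_completeLift h.isOpen (h.slitSmooth hn) (posHom_metricF μ τ η γ f)
      (fun x hx y hy => h.det_ne_zero hn hx hy) (contDiff_fieldV τ η γ Q).contDiffOn hx hy]
    have e1 : fderiv ℝ (fun u => metricF μ τ η γ f u y) x
        = fderiv ℝ (fun u => alphaMu μ u y) x + fderiv ℝ (fun u => betaForm μ τ η γ f u y) x :=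
      fderiv_fun_add (hα.differentiableAt_base hx hy) (hβ.differentiableAt_base hx hy)
    have e2 : fderiv ℝ (metricF μ τ η γ f x) y
        = fderiv ℝ (alphaMu μ x) y + betaForm μ τ η γ f x := by
      have := fderiv_fun_add (hα.differentiableAt_fiber hx hy) (hβ.differentiableAt_fiber hx hy)
      rw [ContinuousLinearMap.fderiv] at this
      exact this
    have e3 : metricF μ τ η γ f x y = alphaMu μ x y + betaForm μ τ η γ f x y := rfl
    rw [e1, e2, add_apply, add_apply, e3]
    linear_combination (alphaMu μ x y + betaForm μ τ η γ f x y) * (h1 + h2)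

/-- The factor `c` is constant on no nonempty open set unless `μγ + η = 0`. -/
theorem factor_not_constant (hn : 2 ≤ n) (hU : IsOpen U) (hne : U.Nonempty)
    (hD : ∀ x ∈ U, 0 < 1 + μ * ‖x‖ ^ 2) (ha : μ • γ + η ≠ 0) (k : ℝ) :
    ∃ x ∈ U, factor μ τ η γ x ≠ k := by
  by_contra! hk
  -- the differential of `c` vanishes on `U`, which forces `μγ + η` to be a multiple of `x`
  have h1 : ∀ x ∈ U, μ • γ + η = (2 * μ * (k + τ)) • x := by
    intro x hx
    have hDx := hD x hx
    refine ext_inner_right ℝ fun v => ?_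
    have h0 : fderiv ℝ (factor μ τ η γ) x v = 0 := by
      have : factor μ τ η γ =ᶠ[𝓝 x] fun _ => k := by
        filter_upwards [hU.mem_nhds hx] with u hu using hk u hu
      rw [this.fderiv_eq]
      simp
    have hkx : τ * (1 - μ * ‖x‖ ^ 2) + ⟪μ • γ + η, x⟫ = k * (1 + μ * ‖x‖ ^ 2) := by
      have := hk x hx
      rwa [factor, div_eq_iff hDx.ne'] at this
    rw [fderiv_factor hDx.ne', div_eq_zero_iff, hkx] at h0
    have h2 := h0.resolve_right (by positivity)
    have h3 : (1 + μ * ‖x‖ ^ 2) * (⟪μ • γ + η, v⟫ - 2 * μ * (k + τ) * ⟪x, v⟫) = 0 := by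
      linear_combination h2
    rw [real_inner_smul_left]
    exact sub_eq_zero.1 ((mul_eq_zero.1 h3).resolve_left hDx.ne')
  obtain ⟨x, hx⟩ := hne
  obtain ⟨y, hy⟩ := exists_ne_zero hn
  have hev : ∀ᶠ t in 𝓝[≠] (0 : ℝ), x + t • y ∈ U := by
    have hc : ContinuousAt (fun t : ℝ => x + t • y) 0 := by fun_prop
    exact (hc.eventually_mem (hU.mem_nhds (by simpa using hx))).filter_mono nhdsWithin_le_nhds
  obtain ⟨t, htU, ht⟩ := (hev.and self_mem_nhdsWithin).exists
  have h2 := (h1 x hx).symm.trans (h1 _ htU)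
  rw [smul_add, left_eq_add, smul_smul] at h2
  have h3 : 2 * μ * (k + τ) = 0 :=
    (mul_eq_zero.1 ((smul_eq_zero.1 h2).resolve_right hy)).resolve_right ht
  exact ha (by rw [h1 x hx, h3, zero_smul])

theorem Admissible.not_isHomothetic (hn : 2 ≤ n) (h : Admissible μ τ η γ Q f U)
    (ha : μ • γ + η ≠ 0) : ¬ IsHomothetic U (metricF μ τ η γ f) (fieldV τ η γ Q) := by
  rintro ⟨k, hk⟩
  obtain ⟨x, hx, hne⟩ :=
    factor_not_constant (τ := τ) hn h.isOpen h.nonempty (h.denom_pos hn) ha k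
  obtain ⟨y, hy⟩ := exists_ne_zero hn
  have hpos := h.pos hx hy
  have h1 := (hk.eq x hx y hy).symm.trans ((h.isConformalWith hn).eq x hx y hy)
  have h2 := mul_right_cancel₀ (pow_ne_zero 2 hpos.ne') h1
  exact hne (by linarith)

/-- `Γⁱ_jk = 2μ xⁱ δ_jk / (1 + μ|x|²)`. -/
theorem Admissible.isDouglas (hn : 2 ≤ n) (h : Admissible μ τ η γ Q f U) :
    IsDouglas U (metricF μ τ η γ f) := by
  have hD := h.denom_pos hn
  have hα := slitSmooth_alphaMu hD
  have hβ := slitSmooth_clm h.isOpen h.isRanders.smooth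
  refine ⟨fun x i j k => if j = k then 2 * μ / (1 + μ * ‖x‖ ^ 2) * x i else 0, fun x y =>
    (fderiv ℝ (fun u => metricF μ τ η γ f u y) x y - fderiv ℝ (metricF μ τ η γ f x) y
      ((2 * μ * ‖y‖ ^ 2 / (1 + μ * ‖x‖ ^ 2)) • x)) / (2 * metricF μ τ η γ f x y), ?_⟩
  intro x hx y hy i
  have hDx := hD x hx
  rw [sprayCoeff_of_eulerLagrange h.isOpen (h.slitSmooth hn) (posHom_metricF μ τ η γ f) hx hy
    (h.pos hx hy).ne' (h.det_ne_zero hn hx hy) ((2 * μ * ‖y‖ ^ 2 / (1 + μ * ‖x‖ ^ 2)) • x)]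
  · congr 1
    simp only [ite_mul, zero_mul, Finset.sum_ite_eq, Finset.mem_univ, if_true, PiLp.smul_apply,
      smul_eq_mul, EuclideanSpace.real_norm_sq_eq y, Finset.mul_sum, Finset.sum_div, Finset.sum_mul]
    exact Finset.sum_congr rfl fun j _ => by ring
  · intro v
    have h1 : eulerLagrange (metricF μ τ η γ f) x y v = eulerLagrange (alphaMu μ) x y v
        + eulerLagrange (fun x y => betaForm μ τ η γ f x y) x y v :=
      eulerLagrange_add h.isOpen hα hβ hx hy v
    have h2 : eulerLagrange (fun x y => betaForm μ τ η γ f x y) x y v = 0 :=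
      eulerLagrange_closed (contDiffAt_factor hDx.ne') (h.ode _ ⟨x, hx, rfl⟩).1 y v
    have hy' := norm_ne_zero_iff.2 hy
    rw [h1, h2, eulerLagrange_alphaMu h.isOpen hD hx hy,
      verticalHessian_randers (fun z hz => scaling_ne_zero hDx hz) (metricF_eq hDx) hy,
      norm_scaling hDx, alphaMu]
    simp only [scaling_apply, real_inner_smul_left, real_inner_smul_right, real_inner_comm v x,
      real_inner_comm y x]
    field_simp
    ring

end Admissible

/-! ### Projective coordinates -/

section Chart

variable {n : ℕ}

/-- The affine function `z = 1 - ⟨b,X⟩`. -/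
def affineHeight (b X : E n) : ℝ := 1 - ⟪b, X⟫

/-- The quadratic form `μ|W|² + Z²` on the affine hyperplane of the points `(X, 1 - ⟨b,X⟩)`. -/
def quadric (μ : ℝ) (b X : E n) : ℝ := affineHeight b X ^ 2 + μ * ‖X‖ ^ 2

/-- Central projection of the quadric `μ|W|² + Z² = 1`, written in stereographic coordinates
`(W, Z) = (2x, 1 - μ|x|²) / (1 + μ|x|²)`, to the hyperplane `Z + ⟨b,W⟩ = 1`. -/
def gnomonic (μ : ℝ) (b x : E n) : E n := (2 / (1 - μ * ‖x‖ ^ 2 + 2 * ⟪b, x⟫)) • x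

/-- The inverse of `gnomonic`. -/
def gnomonicInv (μ : ℝ) (b X : E n) : E n := (affineHeight b X + √(quadric μ b X))⁻¹ • X

/-- The image of the chart: the points `X` of the projective model on which `gnomonicInv` is
regular. -/
def gnomonicDomain (μ : ℝ) (b : E n) : Set (E n) :=
  {X | 0 < quadric μ b X ∧ 0 < affineHeight b X + √(quadric μ b X)}

variable {μ : ℝ} {b : E n}

theorem gnomonic_props {x : E n} (hD : 0 < 1 + μ * ‖x‖ ^ 2)
    (hl : 0 < 1 - μ * ‖x‖ ^ 2 + 2 * ⟪b, x⟫) :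
    gnomonic μ b x ∈ gnomonicDomain μ b ∧ gnomonicInv μ b (gnomonic μ b x) = x := by
  have hz : affineHeight b (gnomonic μ b x)
      = (1 - μ * ‖x‖ ^ 2) / (1 - μ * ‖x‖ ^ 2 + 2 * ⟪b, x⟫) := by
    rw [affineHeight, gnomonic, real_inner_smul_right]
    field_simp
    ring
  have hq : quadric μ b (gnomonic μ b x)
      = ((1 + μ * ‖x‖ ^ 2) / (1 - μ * ‖x‖ ^ 2 + 2 * ⟪b, x⟫)) ^ 2 := by
    rw [quadric, hz, gnomonic, norm_smul, mul_pow, Real.norm_eq_abs, sq_abs]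
    field_simp
    ring
  have hs : √(quadric μ b (gnomonic μ b x))
      = (1 + μ * ‖x‖ ^ 2) / (1 - μ * ‖x‖ ^ 2 + 2 * ⟪b, x⟫) := by
    rw [hq, Real.sqrt_sq (by positivity)]
  have hzs : affineHeight b (gnomonic μ b x) + √(quadric μ b (gnomonic μ b x))
      = 2 / (1 - μ * ‖x‖ ^ 2 + 2 * ⟪b, x⟫) := by
    rw [hs, hz, ← add_div]
    ring_nf
  refine ⟨⟨?_, ?_⟩, ?_⟩
  · rw [hq]; positivity
  · rw [hzs]; positivity
  · rw [gnomonicInv, hzs, gnomonic, smul_smul, inv_mul_cancel₀ (by positivity), one_smul]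

theorem denom_gnomonicInv {X : E n} (hX : X ∈ gnomonicDomain μ b) :
    1 + μ * ‖gnomonicInv μ b X‖ ^ 2
      = 2 * √(quadric μ b X) / (affineHeight b X + √(quadric μ b X)) := by
  obtain ⟨hq, hzs⟩ := hX
  have hs := Real.sq_sqrt hq.le
  rw [gnomonicInv, norm_smul, mul_pow, norm_inv, Real.norm_eq_abs, inv_pow, sq_abs]
  set s := √(quadric μ b X)
  rw [quadric] at hs
  field_simp
  linear_combination -hs

theorem gnomonic_gnomonicInv {X : E n} (hX : X ∈ gnomonicDomain μ b) :
    gnomonic μ b (gnomonicInv μ b X) = X := by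
  have hD := denom_gnomonicInv hX
  obtain ⟨hq, hzs⟩ := hX
  have hl : 1 - μ * ‖gnomonicInv μ b X‖ ^ 2 + 2 * ⟪b, gnomonicInv μ b X⟫
      = 2 / (affineHeight b X + √(quadric μ b X)) := by
    have h1 : ⟪b, gnomonicInv μ b X⟫
        = (1 - affineHeight b X) / (affineHeight b X + √(quadric μ b X)) := by
      rw [gnomonicInv, real_inner_smul_right, affineHeight]
      ring
    have h2 : μ * ‖gnomonicInv μ b X‖ ^ 2
        = 2 * √(quadric μ b X) / (affineHeight b X + √(quadric μ b X)) - 1 := by linarith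
    rw [h1, h2]
    field_simp
    ring
  rw [gnomonic, hl]
  rw [gnomonicInv, smul_smul]
  rw [show 2 / (2 / (affineHeight b X + √(quadric μ b X)))
    * (affineHeight b X + √(quadric μ b X))⁻¹ = 1 by field_simp, one_smul]

theorem contDiff_affineHeight (b : E n) : ContDiff ℝ ∞ (affineHeight b) :=
  contDiff_const.sub (contDiff_const.inner ℝ contDiff_id)

theorem contDiff_quadric (μ : ℝ) (b : E n) : ContDiff ℝ ∞ (quadric μ b) :=
  ((contDiff_affineHeight b).pow 2).add (contDiff_const.mul (contDiff_id.norm_sq ℝ))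

theorem isOpen_gnomonicDomain (μ : ℝ) (b : E n) : IsOpen (gnomonicDomain μ b) :=
  (isOpen_lt continuous_const (contDiff_quadric μ b).continuous).inter
    (isOpen_lt continuous_const ((contDiff_affineHeight b).continuous.add
      (contDiff_quadric μ b).continuous.sqrt))

theorem contDiffOn_gnomonicInv (μ : ℝ) (b : E n) :
    ContDiffOn ℝ ∞ (gnomonicInv μ b) (gnomonicDomain μ b) := fun _ hX =>
  ((((contDiff_affineHeight b).contDiffAt.add
    ((contDiff_quadric μ b).contDiffAt.sqrt hX.1.ne')).inv hX.2.ne').smul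
      contDiffAt_id).contDiffWithinAt

theorem contDiffAt_gnomonic {x : E n} (hl : 0 < 1 - μ * ‖x‖ ^ 2 + 2 * ⟪b, x⟫) :
    ContDiffAt ℝ ∞ (gnomonic μ b) x := by
  have h1 : ContDiffAt ℝ ∞ (fun x : E n => ‖x‖ ^ 2) x := contDiffAt_id.norm_sq ℝ
  have h2 : ContDiffAt ℝ ∞ (fun x : E n => ⟪b, x⟫) x := contDiffAt_const.inner ℝ contDiffAt_id
  exact (contDiffAt_const.div ((contDiffAt_const.sub (contDiffAt_const.mul h1)).add
    (contDiffAt_const.mul h2)) hl.ne').smul contDiffAt_id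

/-- The chart `gnomonic μ b`, restricted to the part of the open set `U` where it is regular. -/
def gnomonicChart (μ : ℝ) (b : E n) (U : Set (E n)) (hU : IsOpen U)
    (hD : ∀ x ∈ U, 0 < 1 + μ * ‖x‖ ^ 2) : OpenPartialHomeomorph (E n) (E n) where
  toFun := gnomonic μ b
  invFun := gnomonicInv μ b
  source := U ∩ {x | 0 < 1 - μ * ‖x‖ ^ 2 + 2 * ⟪b, x⟫}
  target := gnomonicDomain μ b ∩
    gnomonicInv μ b ⁻¹' (U ∩ {x | 0 < 1 - μ * ‖x‖ ^ 2 + 2 * ⟪b, x⟫})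
  map_source' x hx := by
    obtain ⟨h1, h2⟩ := gnomonic_props (hD x hx.1) hx.2
    exact ⟨h1, by rwa [Set.mem_preimage, h2]⟩
  map_target' X hX := hX.2
  left_inv' x hx := (gnomonic_props (hD x hx.1) hx.2).2
  right_inv' X hX := gnomonic_gnomonicInv hX.1
  open_source := hU.inter (isOpen_lt continuous_const (by fun_prop))
  open_target := (contDiffOn_gnomonicInv μ b).continuousOn.isOpen_inter_preimage
    (isOpen_gnomonicDomain μ b) (hU.inter (isOpen_lt continuous_const (by fun_prop)))
  continuousOn_toFun x hx := (contDiffAt_gnomonic hx.2).continuousAt.continuousWithinAt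
  continuousOn_invFun := (contDiffOn_gnomonicInv μ b).continuousOn.mono Set.inter_subset_left

/-- The quadratic form `|zY - ż X|² + μ(|X|²|Y|² - ⟨X,Y⟩²)` with `z = 1 - ⟨b,X⟩` and
`ż = -⟨b,Y⟩`: up to the factor `μ`, the Gram determinant of `(X,z)` and `(Y,ż)`
for `μ|W|² + Z²`. -/
def gram (μ : ℝ) (b X Y : E n) : ℝ :=
  affineHeight b X ^ 2 * ‖Y‖ ^ 2 + 2 * affineHeight b X * ⟪b, Y⟫ * ⟪X, Y⟫ + ⟪b, Y⟫ ^ 2 * ‖X‖ ^ 2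
    + μ * (‖X‖ ^ 2 * ‖Y‖ ^ 2 - ⟪X, Y⟫ ^ 2)

theorem hasDerivAt_affineHeight_line (b X v : E n) :
    HasDerivAt (fun t : ℝ => affineHeight b (X + t • v)) (-⟪b, v⟫) 0 :=
  (hasDerivAt_inner_line b X v).const_sub 1

theorem hasDerivAt_quadric_line (μ : ℝ) (b X v : E n) :
    HasDerivAt (fun t : ℝ => quadric μ b (X + t • v))
      (2 * (μ * ⟪X, v⟫ - affineHeight b X * ⟪b, v⟫)) 0 := by
  refine (((hasDerivAt_affineHeight_line b X v).pow 2).add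
    ((hasDerivAt_norm_sq_line X v).const_mul μ)).congr_deriv ?_
  simp
  ring

theorem fderiv_gnomonicInv {X : E n} (hX : X ∈ gnomonicDomain μ b) (Y : E n) :
    fderiv ℝ (gnomonicInv μ b) X Y = (affineHeight b X + √(quadric μ b X))⁻¹ • Y
      - ((μ * ⟪X, Y⟫ - (affineHeight b X + √(quadric μ b X)) * ⟪b, Y⟫)
        / (√(quadric μ b X) * (affineHeight b X + √(quadric μ b X)) ^ 2)) • X := by
  have hd := ((contDiffOn_gnomonicInv μ b).contDiffAt
    ((isOpen_gnomonicDomain μ b).mem_nhds hX)).differentiableAt (by simp)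
  rw [← hd.lineDeriv_eq_fderiv]
  refine HasDerivAt.deriv ?_
  have hs := Real.sqrt_pos.2 hX.1
  have h := (((hasDerivAt_affineHeight_line b X Y).add ((hasDerivAt_quadric_line μ b X Y).sqrt
    (by simpa using hX.1.ne'))).inv (by simpa using hX.2.ne')).smul (hasDerivAt_line X Y)
  refine h.congr_deriv ?_
  have h2 := hX.2
  simp only [zero_smul, add_zero, Pi.add_apply, Pi.inv_apply, sub_eq_add_neg, ← neg_smul]
  congr 2
  field_simp
  ring

/-- In projective coordinates `α` is Beltrami's expression `√gram / quadric`. -/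
theorem alphaMu_gnomonicInv {X : E n} (hX : X ∈ gnomonicDomain μ b) (Y : E n) :
    alphaMu μ (gnomonicInv μ b X) (fderiv ℝ (gnomonicInv μ b) X Y)
      = √(gram μ b X Y) / quadric μ b X := by
  rw [alphaMu, denom_gnomonicInv hX, fderiv_gnomonicInv hX]
  obtain ⟨hq, hzs⟩ := hX
  have hs := Real.sqrt_pos.2 hq
  have hsq := Real.sq_sqrt hq.le
  have hsq' := hsq
  set s := √(quadric μ b X)
  rw [quadric] at hsq'
  set z := affineHeight b X with hz
  have key : gram μ b X Y = (2 / (2 * s / (z + s)) * ‖(z + s)⁻¹ • Y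
      - ((μ * ⟪X, Y⟫ - (z + s) * ⟪b, Y⟫) / (s * (z + s) ^ 2)) • X‖ * s ^ 2) ^ 2 := by
    rw [mul_pow, mul_pow, norm_sub_sq_real, norm_smul, norm_smul, real_inner_smul_left,
      real_inner_smul_right, mul_pow, mul_pow, Real.norm_eq_abs, Real.norm_eq_abs, sq_abs, sq_abs,
      gram, ← hz, real_inner_comm X Y]
    field_simp
    linear_combination -(‖Y‖ ^ 2 * (z + s) ^ 2 + 2 * (z + s) * ⟪b, Y⟫ * ⟪X, Y⟫
      - μ * ⟪X, Y⟫ ^ 2) * hsq'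
  rw [key, Real.sqrt_sq (by positivity), ← hsq, mul_div_cancel_right₀ _ (by positivity)]

end Chart

/-! ### Local projective flatness -/

section ProjectivelyFlat

variable {n : ℕ} {U W : Set (E n)} {ψ : E n → E n}

/-- The expression of `f` in new coordinates: `ψ` is the inverse of the coordinate map. -/
def pullback (ψ : E n → E n) (f : E n → E n → ℝ) (x y : E n) : ℝ := f (ψ x) (fderiv ℝ ψ x y)

theorem SlitSmooth.pullback {f : E n → E n → ℝ} (hf : SlitSmooth U f) (hW : IsOpen W)
    (hψ : ContDiffOn ℝ ∞ ψ W) (hmap : Set.MapsTo ψ W U)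
    (hinj : ∀ x ∈ W, ∀ y, y ≠ 0 → fderiv ℝ ψ x y ≠ 0) : SlitSmooth W (pullback ψ f) := by
  intro x hx y hy
  have h := hψ.contDiffAt (hW.mem_nhds hx)
  have h1 : ContDiffAt ℝ ∞ (fun p : E n × E n => ψ p.1) (x, y) := h.comp (x, y) contDiffAt_fst
  have h2 : ContDiffAt ℝ ∞ (fun p : E n × E n => fderiv ℝ ψ p.1 p.2) (x, y) :=
    ((h.fderiv_right (m := ∞) (by simp)).comp (x, y) contDiffAt_fst).clm_apply contDiffAt_snd
  exact (hf (ψ x) (hmap hx) _ (hinj x hx y hy)).comp (x, y) (h1.prodMk h2)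

theorem eulerLagrange_congr {f g : E n → E n → ℝ} {x : E n}
    (h : ∀ᶠ u in 𝓝 x, ∀ y, f u y = g u y) (y v : E n) :
    eulerLagrange f x y v = eulerLagrange g x y v := by
  have h1 : (fun u => fderiv ℝ (f u) y v) =ᶠ[𝓝 x] fun u => fderiv ℝ (g u) y v := by
    filter_upwards [h] with u hu
    rw [funext hu]
  have h2 : (fun u => f u y) =ᶠ[𝓝 x] fun u => g u y := by
    filter_upwards [h] with u hu using hu y
  rw [eulerLagrange, eulerLagrange, h1.fderiv_eq, h2.fderiv_eq]

/-- A differentiable left inverse makes the differential injective. -/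
theorem fderiv_ne_zero_of_leftInverse {φ ψ : E n → E n} {x : E n} (hψ : DifferentiableAt ℝ ψ x)
    (hφ : DifferentiableAt ℝ φ (ψ x)) (h : ∀ᶠ u in 𝓝 x, φ (ψ u) = u) {y : E n} (hy : y ≠ 0) :
    fderiv ℝ ψ x y ≠ 0 := by
  intro h0
  have h1 := (hφ.hasFDerivAt.comp x hψ.hasFDerivAt).congr_of_eventuallyEq
    (f₁ := fun u => u) (by filter_upwards [h] with u hu using hu.symm)
  have h2 := congrArg (fun L => L y) (h1.unique (hasFDerivAt_id x))
  simp only [ContinuousLinearMap.comp_apply, h0, map_zero, ContinuousLinearMap.id_apply] at h2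
  exact hy h2.symm

variable {μ : ℝ} {b : E n}

/-- The polarisation `½ ∂gram/∂Y · v`. -/
def gramFiber (μ : ℝ) (b X Y v : E n) : ℝ :=
  affineHeight b X ^ 2 * ⟪Y, v⟫ + affineHeight b X * (⟪b, v⟫ * ⟪X, Y⟫ + ⟪b, Y⟫ * ⟪X, v⟫)
    + ⟪b, Y⟫ * ⟪b, v⟫ * ‖X‖ ^ 2 + μ * (‖X‖ ^ 2 * ⟪Y, v⟫ - ⟪X, Y⟫ * ⟪X, v⟫)

theorem hasDerivAt_gram_fiber (X Y v : E n) :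
    HasDerivAt (fun t : ℝ => gram μ b X (Y + t • v)) (2 * gramFiber μ b X Y v) 0 := by
  have hn := hasDerivAt_norm_sq_line Y v
  have hb := hasDerivAt_inner_line b Y v
  have hX := hasDerivAt_inner_line X Y v
  refine ((((hn.const_mul (affineHeight b X ^ 2)).add
    ((hb.const_mul (2 * affineHeight b X)).mul hX)).add ((hb.pow 2).mul_const (‖X‖ ^ 2))).add
    (((hn.const_mul (‖X‖ ^ 2)).sub (hX.pow 2)).const_mul μ)).congr_deriv ?_
  simp [gramFiber]
  ring

theorem hasDerivAt_gram_base (X Y v : E n) :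
    HasDerivAt (fun t : ℝ => gram μ b (X + t • v) Y)
      (-2 * affineHeight b X * ⟪b, v⟫ * ‖Y‖ ^ 2 - 2 * ⟪b, v⟫ * ⟪b, Y⟫ * ⟪X, Y⟫
        + 2 * affineHeight b X * ⟪b, Y⟫ * ⟪Y, v⟫ + 2 * ⟪b, Y⟫ ^ 2 * ⟪X, v⟫
        + 2 * μ * (⟪X, v⟫ * ‖Y‖ ^ 2 - ⟪X, Y⟫ * ⟪Y, v⟫)) 0 := by
  have hn := hasDerivAt_norm_sq_line X v
  have hz := hasDerivAt_affineHeight_line b X v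
  have hY : HasDerivAt (fun t : ℝ => ⟪X + t • v, Y⟫) ⟪Y, v⟫ 0 := by
    simpa only [real_inner_comm] using hasDerivAt_inner_line Y X v
  refine (((((hz.pow 2).mul_const (‖Y‖ ^ 2)).add
    (((hz.const_mul 2).mul_const ⟪b, Y⟫).mul hY)).add (hn.const_mul (⟪b, Y⟫ ^ 2))).add
    (((hn.mul_const (‖Y‖ ^ 2)).sub (hY.pow 2)).const_mul μ)).congr_deriv ?_
  simp
  ring

theorem hasDerivAt_gramFiber_base (X Y v : E n) :
    HasDerivAt (fun t : ℝ => gramFiber μ b (X + t • Y) Y v)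
      (-affineHeight b X * ⟪b, Y⟫ * ⟪Y, v⟫ + affineHeight b X * ⟪b, v⟫ * ‖Y‖ ^ 2
        - ⟪b, Y⟫ ^ 2 * ⟪X, v⟫ + ⟪b, Y⟫ * ⟪b, v⟫ * ⟪X, Y⟫
        + μ * (⟪X, Y⟫ * ⟪Y, v⟫ - ‖Y‖ ^ 2 * ⟪X, v⟫)) 0 := by
  have hn := hasDerivAt_norm_sq_line X Y
  have hz := hasDerivAt_affineHeight_line b X Y
  have hY : HasDerivAt (fun t : ℝ => ⟪X + t • Y, Y⟫) (‖Y‖ ^ 2) 0 := by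
    simpa only [real_inner_comm, real_inner_self_eq_norm_sq] using hasDerivAt_inner_line Y X Y
  have hv : HasDerivAt (fun t : ℝ => ⟪X + t • Y, v⟫) ⟪Y, v⟫ 0 := by
    simpa only [real_inner_comm] using hasDerivAt_inner_line v X Y
  refine (((((hz.pow 2).mul_const ⟪Y, v⟫).add
    (hz.mul ((hY.const_mul ⟪b, v⟫).add (hv.const_mul ⟪b, Y⟫)))).add
    (hn.const_mul (⟪b, Y⟫ * ⟪b, v⟫))).add
    (((hn.mul_const ⟪Y, v⟫).sub (hY.mul hv)).const_mul μ)).congr_deriv ?_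
  simp
  ring

/-- Moving the base point along the straight line in the direction `Y` does not change `gram`. -/
theorem gram_line (X Y : E n) (t : ℝ) : gram μ b (X + t • Y) Y = gram μ b X Y := by
  simp only [gram, affineHeight, inner_add_left, inner_add_right, real_inner_smul_left,
    real_inner_smul_right, norm_add_sq_real, norm_smul, mul_pow, Real.norm_eq_abs, sq_abs,
    real_inner_self_eq_norm_sq]
  ring

/-- The Euler–Lagrange expression of `√gram / quadric` vanishes: its geodesics are straight
lines. -/
theorem eulerLagrange_beltrami {X Y : E n} (hW : IsOpen W) {h : E n → E n → ℝ}
    (hh : SlitSmooth W h) (heq : ∀ x ∈ W, ∀ y, h x y = √(gram μ b x y) / quadric μ b x)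
    (hq : ∀ x ∈ W, 0 < quadric μ b x) (hpos : ∀ x ∈ W, ∀ y, y ≠ 0 → 0 < h x y)
    (hX : X ∈ W) (hY : Y ≠ 0) (v : E n) : eulerLagrange h X Y v = 0 := by
  have hg (x : E n) (hx : x ∈ W) (y : E n) (hy : y ≠ 0) : 0 < gram μ b x y := by
    have := hpos x hx y hy
    rw [heq x hx] at this
    exact Real.sqrt_pos.1 ((div_pos_iff_of_pos_right (hq x hx)).1 this)
  have h1 (x : E n) (hx : x ∈ W) : fderiv ℝ (h x) Y v
      = gramFiber μ b x Y v / (√(gram μ b x Y) * quadric μ b x) := by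
    refine fderiv_apply_eq_of_hasDerivAt (hh.differentiableAt_fiber hx hY) ?_
    simp only [heq x hx]
    have hg' := Real.sqrt_pos.2 (hg x hx Y hY)
    refine (((hasDerivAt_gram_fiber x Y v).sqrt (by simpa using (hg x hx Y hY).ne')).div_const
      (quadric μ b x)).congr_deriv ?_
    have := hq x hx
    simp only [zero_smul, add_zero]
    field_simp
  have hline (v : E n) : ∀ᶠ t : ℝ in 𝓝 0, X + t • v ∈ W := by
    have hc : ContinuousAt (fun t : ℝ => X + t • v) 0 := by fun_prop
    exact hc.eventually_mem (hW.mem_nhds (by simpa using hX))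
  have hgX := hg X hX Y hY
  have hsX := Real.sqrt_pos.2 hgX
  have hsq := Real.sq_sqrt hgX.le
  have hqX := hq X hX
  have d2 := (hasDerivAt_gramFiber_base (μ := μ) (b := b) X Y v).div
    ((hasDerivAt_quadric_line μ b X Y).const_mul √(gram μ b X Y))
    (by simpa using ⟨hsX.ne', hqX.ne'⟩)
  have h2 := fderiv_apply_eq_of_hasDerivAt
    ((hh.fderiv_fiber hW v).differentiableAt_base hX hY) (d2.congr_of_eventuallyEq
      ((hline Y).mono fun t ht => (h1 _ ht).trans (by rw [gram_line]; rfl)))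
  have d3 := ((hasDerivAt_gram_base (μ := μ) (b := b) X Y v).sqrt (by simpa using hgX.ne')).div
    (hasDerivAt_quadric_line μ b X v) (by simpa using hqX.ne')
  have h3 := fderiv_apply_eq_of_hasDerivAt (hh.differentiableAt_base hX hY)
    (d3.congr_of_eventuallyEq ((hline v).mono fun t ht => heq _ ht Y))
  rw [eulerLagrange, h2, h3]
  simp only [zero_smul, add_zero]
  set s := √(gram μ b X Y)
  rw [sub_eq_zero]
  field_simp
  rw [hsq]
  simp only [gram, gramFiber, quadric]
  ring

end ProjectivelyFlat

section Admissible

variable {n : ℕ} {μ τ : ℝ} {η γ : E n} {Q : Matrix (Fin n) (Fin n) ℝ} {f : ℝ → ℝ} {U : Set (E n)}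

theorem Admissible.isLocallyProjectivelyFlat (hn : 2 ≤ n) (h : Admissible μ τ η γ Q f U) :
    IsLocallyProjectivelyFlat U (metricF μ τ η γ f) := by
  intro p hp
  have hD := h.denom_pos hn
  -- with `b = μ p` the denominator of the chart at `p` equals `1 + μ|p|²`
  set φ := gnomonicChart μ (μ • p) U h.isOpen hD with hφ
  have hsource : ∀ x ∈ φ.source, x ∈ U := fun x hx => hx.1
  have hp' : p ∈ φ.source := by
    refine ⟨hp, ?_⟩
    have := hD p hp
    simp only [Set.mem_ofPred_eq, real_inner_smul_left, real_inner_self_eq_norm_sq]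
    linarith
  have hφs : ContDiffOn ℝ ∞ φ φ.source := fun x hx =>
    (contDiffAt_gnomonic hx.2).contDiffWithinAt
  have hψs : ContDiffOn ℝ ∞ φ.symm φ.target :=
    (contDiffOn_gnomonicInv μ (μ • p)).mono Set.inter_subset_left
  refine ⟨φ, hp', hsource, hφs, hψs, ?_⟩
  have hW := φ.open_target
  have hmap : Set.MapsTo φ.symm φ.target U := fun x hx => hsource _ (φ.map_target hx)
  have hinj : ∀ x ∈ φ.target, ∀ y, y ≠ 0 → fderiv ℝ φ.symm x y ≠ 0 := fun x hx y hy =>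
    fderiv_ne_zero_of_leftInverse (φ := φ)
      ((hψs.contDiffAt (hW.mem_nhds hx)).differentiableAt (by simp))
      ((hφs.contDiffAt (φ.open_source.mem_nhds (φ.map_target hx))).differentiableAt (by simp))
      (φ.eventually_right_inverse hx) hy
  have hα := (slitSmooth_alphaMu hD).pullback hW hψs hmap hinj
  have hβ := (slitSmooth_clm h.isOpen h.isRanders.smooth).pullback hW hψs hmap hinj
  have hF := (h.slitSmooth hn).pullback hW hψs hmap hinj
  have hhom : ∀ x, PosHom 1 (pullback φ.symm (metricF μ τ η γ f) x) := fun x t ht y => by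
    rw [pullback, map_smul, posHom_metricF μ τ η γ f _ t ht]; rfl
  refine ⟨fun x y => (fderiv ℝ (fun u => pullback φ.symm (metricF μ τ η γ f) u y) x y
    - fderiv ℝ (pullback φ.symm (metricF μ τ η γ f) x) y 0)
      / (2 * pullback φ.symm (metricF μ τ η γ f) x y), ?_⟩
  intro x hx y hy i
  have hdet : (fundamentalTensor (pullback φ.symm (metricF μ τ η γ f)) x y).det ≠ 0 := by
    have hDx := hD _ (hmap hx)
    refine det_fundamentalTensor_randers_ne_zero hW hF hx
      (A := (scaling μ (φ.symm x)).comp (fderiv ℝ φ.symm x))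
      (b := (betaForm μ τ η γ f (φ.symm x)).comp (fderiv ℝ φ.symm x))
      (fun z hz => scaling_ne_zero hDx (hinj x hx z hz)) (fun z hz => ?_)
      (fun z => metricF_eq hDx _) hy
    rw [ContinuousLinearMap.comp_apply, ContinuousLinearMap.comp_apply, norm_scaling hDx]
    exact h.isRanders.norm_lt_one _ (hmap hx) _ (hinj x hx z hz)
  have hEα (v : E n) : eulerLagrange (pullback φ.symm (alphaMu μ)) x y v = 0 :=
    eulerLagrange_beltrami hW hα (fun x hx y => alphaMu_gnomonicInv hx.1 y) (fun x hx => hx.1.1)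
      (fun x hx y hy => (h.isRanders.pos (alphaMu_neg μ) (hmap hx) (hinj x hx y hy)).1) hx hy v
  -- the pull-back of `β` is `f(c̃) dc̃` with `c̃` the factor in the new coordinates, hence closed
  have hEβ (v : E n) :
      eulerLagrange (pullback φ.symm fun x y => betaForm μ τ η γ f x y) x y v = 0 := by
    have hc (u : E n) (hu : u ∈ φ.target) : ContDiffAt ℝ ∞ (factor μ τ η γ) (φ.symm u) :=
      contDiffAt_factor (hD _ (hmap hu)).ne'
    have hψ (u : E n) (hu : u ∈ φ.target) := hψs.contDiffAt (hW.mem_nhds hu)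
    rw [eulerLagrange_congr (g := fun u z => (f ((factor μ τ η γ ∘ φ.symm) u)
      • fderiv ℝ (factor μ τ η γ ∘ φ.symm) u) z)]
    · exact eulerLagrange_closed ((hc x hx).comp x (hψ x hx)) (h.ode _ ⟨_, hmap hx, rfl⟩).1 y v
    · filter_upwards [hW.mem_nhds hx] with u hu z
      rw [fderiv_comp u ((hc u hu).differentiableAt (by simp))
        ((hψ u hu).differentiableAt (by simp))]
      rfl
  have hEF (v : E n) : eulerLagrange (pullback φ.symm (metricF μ τ η γ f)) x y v
      = verticalHessian (pullback φ.symm (metricF μ τ η γ f)) x y v 0 := by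
    rw [verticalHessian, map_zero]
    have := eulerLagrange_add hW hα hβ hx hy v
    rw [hEα, hEβ, add_zero] at this
    exact this
  have := sprayCoeff_of_eulerLagrange hW hF hhom hx hy
    (h.pos (hmap hx) (hinj x hx y hy)).ne' hdet 0 hEF i
  rw [PiLp.zero_apply, mul_zero, zero_add] at this
  exact this

end Admissible

/-! ### Admissible data with `β` nowhere zero -/

section Existence

variable {n : ℕ}

theorem isRiemannianOn_alphaMu {μ : ℝ} {U : Set (E n)} (hD : ∀ x ∈ U, 0 < 1 + μ * ‖x‖ ^ 2) :
    IsRiemannianOn U (alphaMu μ) := by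
  refine ⟨fun x => Matrix.diagonal fun _ => (2 / (1 + μ * ‖x‖ ^ 2)) ^ 2, fun i j => ?_,
    fun x hx => ⟨?_, fun y => ?_⟩⟩
  · by_cases hij : i = j
    · subst hij
      simp only [Matrix.diagonal_apply_eq]
      intro x hx
      have h1 : ContDiffAt ℝ ∞ (fun x : E n => ‖x‖ ^ 2) x := contDiffAt_id.norm_sq ℝ
      exact ((contDiffAt_const.div (contDiffAt_const.add (contDiffAt_const.mul h1))
        (hD x hx).ne').pow 2).contDiffWithinAt
    · simp only [Matrix.diagonal_apply_ne _ hij]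
      exact contDiffOn_const
  · have := hD x hx
    exact Matrix.PosDef.diagonal fun _ => by positivity
  · have := hD x hx
    have h1 : ∑ i, ∑ j, (Matrix.diagonal fun _ : Fin n => (2 / (1 + μ * ‖x‖ ^ 2)) ^ 2) i j
        * y i * y j = alphaMu μ x y ^ 2 := by
      simp only [Matrix.diagonal_apply, ite_mul, zero_mul, Finset.sum_ite_eq, Finset.mem_univ,
        if_true, alphaMu, mul_pow, EuclideanSpace.real_norm_sq_eq y, Finset.mul_sum]
      exact Finset.sum_congr rfl fun _ _ => by ring
    rw [h1, Real.sqrt_sq]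
    exact mul_nonneg (by positivity) (norm_nonneg y)

/-- The solution `ε / √(2μ² - 2μt²)` of the differential equation of `f` for `τ = 0`, `|γ| = 1` and
`η = μγ`. -/
def profile (μ ε t : ℝ) : ℝ := ε / √(2 * μ ^ 2 - 2 * μ * t ^ 2)

theorem hasDerivAt_profile {μ t : ℝ} (ε : ℝ) (ht : 0 < 2 * μ ^ 2 - 2 * μ * t ^ 2) :
    HasDerivAt (profile μ ε) (ε * (2 * μ * t) /
      (√(2 * μ ^ 2 - 2 * μ * t ^ 2) * (2 * μ ^ 2 - 2 * μ * t ^ 2))) t := by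
  have h1 : HasDerivAt (fun t : ℝ => 2 * μ ^ 2 - 2 * μ * t ^ 2) (-(2 * μ * (2 * t))) t := by
    simpa using ((hasDerivAt_pow 2 t).const_mul (2 * μ)).const_sub (2 * μ ^ 2)
  have hs := Real.sqrt_pos.2 ht
  refine ((hasDerivAt_const t ε).div (h1.sqrt ht.ne') hs.ne').congr_deriv ?_
  rw [Real.sq_sqrt ht.le]
  field_simp
  ring

theorem contDiffAt_betaForm_profile {μ τ : ℝ} {η γ x : E n} (ε : ℝ) (hD : 1 + μ * ‖x‖ ^ 2 ≠ 0)
    (hw : 0 < 2 * μ ^ 2 - 2 * μ * factor μ τ η γ x ^ 2) :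
    ContDiffAt ℝ ∞ (betaForm μ τ η γ (profile μ ε)) x := by
  have hc : ContDiffAt ℝ ∞ (factor μ τ η γ) x := contDiffAt_factor hD
  have hr : ContDiffAt ℝ ∞ (fun u => √(2 * μ ^ 2 - 2 * μ * factor μ τ η γ u ^ 2)) x :=
    (contDiffAt_const.sub (contDiffAt_const.mul (hc.pow 2))).sqrt hw.ne'
  exact (contDiffAt_const.div hr (Real.sqrt_pos.2 hw).ne').smul
    (hc.fderiv_right (m := ∞) (by simp))

/-- The data are `τ = 0`, `Q = 0`, `η = μγ` with `γ` a unit vector, a small multiple of the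
solution `f`, and a small neighbourhood of the origin. -/
theorem exists_admissible (hn : 2 ≤ n) {μ : ℝ} (hμ : μ ≠ 0) :
    ∃ (τ : ℝ) (η γ : E n) (Q : Matrix (Fin n) (Fin n) ℝ) (f : ℝ → ℝ) (U : Set (E n)),
      Admissible μ τ η γ Q f U ∧ μ • γ + η ≠ 0 ∧ ∀ x ∈ U, betaForm μ τ η γ f x ≠ 0 := by
  set γ : E n := EuclideanSpace.single ⟨0, by omega⟩ 1 with hγ
  have hγ1 : ‖γ‖ = 1 := by simp [hγ]
  set η : E n := μ • γ with hη
  have ha : μ • γ + η ≠ 0 := by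
    rw [hη, ← add_smul]
    refine smul_ne_zero (by simpa [← two_mul] using hμ) fun h0 => ?_
    rw [h0, norm_zero] at hγ1
    exact zero_ne_one hγ1
  have hD0 : 1 + μ * ‖(0 : E n)‖ ^ 2 ≠ 0 := by simp
  have hc0 : factor μ 0 η γ 0 = 0 := by simp [factor]
  have hw0 : 0 < 2 * μ ^ 2 - 2 * μ * factor μ 0 η γ 0 ^ 2 := by
    rw [hc0]
    have := pow_pos (abs_pos.2 hμ) 2
    rw [sq_abs] at this
    linarith
  -- this `ε` makes `‖β‖ < 1` at the origin, where `α = 2|y|`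
  set ε : ℝ := (1 + ‖betaForm μ 0 η γ (profile μ 1) 0‖)⁻¹ with hε
  have hεpos : 0 < ε := by positivity
  have hscale : betaForm μ 0 η γ (profile μ ε) 0 = ε • betaForm μ 0 η γ (profile μ 1) 0 := by
    rw [betaForm, betaForm, smul_smul, profile, profile, mul_one_div]
  -- test `dc` at the origin on the vector `μγ + η`
  have hβ0 : betaForm μ 0 η γ (profile μ ε) 0 ≠ 0 := by
    intro h0
    have h1 := congrArg (fun L => L (μ • γ + η)) h0
    rw [betaForm] at h1
    simp only [smul_apply, smul_eq_mul, zero_apply, fderiv_factor hD0] at h1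
    simp only [inner_zero_left, inner_zero_right, real_inner_self_eq_norm_sq, norm_zero] at h1
    have h2 : profile μ ε (factor μ 0 η γ 0) ≠ 0 :=
      (div_pos hεpos (Real.sqrt_pos.2 hw0)).ne'
    have h3 := (mul_eq_zero.1 h1).resolve_left h2
    simp at h3
    exact ha h3
  have hβ1 : ‖betaForm μ 0 η γ (profile μ ε) 0‖ < 2 := by
    rw [hscale, norm_smul, Real.norm_of_nonneg hεpos.le, hε, inv_mul_lt_iff₀ (by positivity)]
    linarith [norm_nonneg (betaForm μ 0 η γ (profile μ 1) (0 : E n))]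
  have hβc : ContinuousAt (betaForm μ 0 η γ (profile μ ε)) 0 :=
    (contDiffAt_betaForm_profile ε hD0 hw0).continuousAt
  have hcc : ContinuousAt (factor μ 0 η γ) 0 := (contDiffAt_factor hD0).continuousAt
  have hDc : ContinuousAt (fun x : E n => 1 + μ * ‖x‖ ^ 2) 0 := by fun_prop
  -- all conditions on a point of `U` are open and hold at the origin
  have hev : ∀ᶠ x in 𝓝 (0 : E n), 0 < 1 + μ * ‖x‖ ^ 2 ∧
      0 < 2 * μ ^ 2 - 2 * μ * factor μ 0 η γ x ^ 2 ∧
      betaForm μ 0 η γ (profile μ ε) x ≠ 0 ∧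
      ‖betaForm μ 0 η γ (profile μ ε) x‖ * (1 + μ * ‖x‖ ^ 2) < 2 := by
    have hwc : ContinuousAt (fun x => 2 * μ ^ 2 - 2 * μ * factor μ 0 η γ x ^ 2) 0 :=
      continuousAt_const.sub (continuousAt_const.mul (hcc.pow 2))
    have hnc : ContinuousAt
        (fun x => ‖betaForm μ 0 η γ (profile μ ε) x‖ * (1 + μ * ‖x‖ ^ 2)) 0 := hβc.norm.mul hDc
    exact (hDc.eventually (lt_mem_nhds (by simp))).and ((hwc.eventually (lt_mem_nhds hw0)).and
      ((hβc.eventually_ne hβ0).and (hnc.eventually (gt_mem_nhds (by simpa using hβ1)))))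
  obtain ⟨U, hUP, hU, h0U⟩ := mem_nhds_iff.1 hev
  refine ⟨0, η, γ, 0, profile μ ε, U, ?_, ha, fun x hx => (hUP hx).2.2.1⟩
  refine ⟨hU, ⟨0, h0U⟩, ⟨isRiemannianOn_alphaMu fun x hx => (hUP hx).1, fun x hx =>
    (contDiffAt_betaForm_profile ε (hUP hx).1.ne' (hUP hx).2.1).contDiffWithinAt, ?_⟩,
    by simp, by simp, ?_, ?_⟩
  · intro x hx y hy
    obtain ⟨hD, -, -, hlt⟩ := hUP hx
    calc betaForm μ 0 η γ (profile μ ε) x y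
        ≤ ‖betaForm μ 0 η γ (profile μ ε) x‖ * ‖y‖ :=
          (le_abs_self _).trans ((betaForm μ 0 η γ (profile μ ε) x).le_opNorm y)
      _ < 2 / (1 + μ * ‖x‖ ^ 2) * ‖y‖ :=
          mul_lt_mul_of_pos_right ((lt_div_iff₀ hD).2 hlt) (norm_pos_iff.2 hy)
  · rintro _ ⟨x, hx, rfl⟩
    have hw := (hUP hx).2.1
    have hd := hasDerivAt_profile ε hw
    refine ⟨hd.differentiableAt, ?_⟩
    have hs := Real.sqrt_pos.2 hw
    have hK : μ * ‖γ‖ ^ 2 + ⟪η, γ⟫ = 2 * μ := by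
      rw [hη, real_inner_smul_left, real_inner_self_eq_norm_sq, hγ1]
      ring
    rw [hd.deriv, profile, add_assoc, hK]
    set s := √(2 * μ ^ 2 - 2 * μ * factor μ 0 η γ x ^ 2)
    rw [div_mul_eq_mul_div, mul_div_assoc', div_eq_div_iff (by positivity) hs.ne']
    ring
  · rw [hη, norm_smul, hγ1, mul_one, Real.norm_eq_abs, sq_abs]
    ring

end Existence

end FinslerChart

end

theorem mainTheorem5 (n : ℕ) (hn : 2 ≤ n) (μ : ℝ) (hμ : μ ≠ 0) :
    (∀ (τ : ℝ) (η γ : E n) (Q : Matrix (Fin n) (Fin n) ℝ) (f : ℝ → ℝ) (U : Set (E n)),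
      Admissible μ τ η γ Q f U → μ • γ + η ≠ 0 →
        IsConformalWith U (metricF μ τ η γ f) (fieldV τ η γ Q) (factor μ τ η γ) ∧
        ¬ IsHomothetic U (metricF μ τ η γ f) (fieldV τ η γ Q) ∧
        IsLocallyProjectivelyFlat U (metricF μ τ η γ f) ∧
        IsDouglas U (metricF μ τ η γ f)) ∧
    (∃ (τ : ℝ) (η γ : E n) (Q : Matrix (Fin n) (Fin n) ℝ) (f : ℝ → ℝ) (U : Set (E n)),
      Admissible μ τ η γ Q f U ∧ ∀ x ∈ U, betaForm μ τ η γ f x ≠ 0) ∧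
    (∃ (U : Set (E n)) (α : E n → E n → ℝ) (β : E n → E n →L[ℝ] ℝ) (V : E n → E n),
      IsOpen U ∧ U.Nonempty ∧ IsRandersOn U α β ∧ (∀ x ∈ U, β x ≠ 0) ∧
      IsLocallyProjectivelyFlat U (randers α β) ∧ IsDouglas U (randers α β) ∧
      IsConformal U (randers α β) V ∧ ¬ IsHomothetic U (randers α β) V) := by
  obtain ⟨τ, η, γ, Q, f, U, h, ha, hβ⟩ := exists_admissible hn hμ
  exact ⟨fun _ _ _ _ _ _ h ha => ⟨h.isConformalWith hn, h.not_isHomothetic hn ha,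
      h.isLocallyProjectivelyFlat hn, h.isDouglas hn⟩,
    ⟨τ, η, γ, Q, f, U, h, hβ⟩,
    ⟨U, alphaMu μ, betaForm μ τ η γ f, fieldV τ η γ Q, h.isOpen, h.nonempty, h.isRanders, hβ,
      h.isLocallyProjectivelyFlat hn, h.isDouglas hn, ⟨_, h.isConformalWith hn⟩,
      h.not_isHomothetic hn ha⟩⟩
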